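/- **Calculus.** Terms of $\mathrm{PCF}_H$, up to renaming of bound variables, are $t ::= x \mid \lambda x.t \mid t\,t \mid \mathbf{0} \mid \mathrm{succ}(t) \mid \mathrm{if}(t,t,x.t) \mid \mathrm{fix}\,x.t$; in $\mathrm{if}(t,s,x.u)$ the variable $x$ is bound in $u$. Natural values are $\mathbf{k} ::= \mathbf{0} \mid \mathrm{succ}(\mathbf{k})$ and values are $\mathbf{v} ::= \lambda x.t \mid \mathbf{k}$. Reduction $\to_\rho$, indexed by rule names $\rho\in\{B,I0,IS,F\}$, is given by $$(\lambda x.t)\,\mathbf{v}\to_B t\{x:=\mathbf{v}\},\quad \mathrm{if}(\mathbf{0},t,x.s)\to_{I0} t,\quad \mathrm{if}(\mathrm{succ}(\mathbf{k}),t,x.s)\to_{IS} s\{x:=\mathbf{k}\},\quad \mathrm{fix}\,x.t\to_F t\{x:=\mathrm{fix}\,x.t\},$$ closed under the contexts $\square\,s$, $t\,\square$, $\mathrm{succ}(\square)$ and $\mathrm{if}(\square,s,x.u)$. The normal forms $\mathrm{NF}_\varepsilon$, $\varepsilon\in\{\mathsf{abs},\mathsf{nat},\mathsf{stuck}\}$,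 are defined inductively: $\lambda x.t\in \mathrm{NF}_{\mathsf{abs}}$; $\mathbf{0}\in \mathrm{NF}_{\mathsf{nat}}$; if $t\in \mathrm{NF}_{\mathsf{nat}}$ then $\mathrm{succ}(t)\in \mathrm{NF}_{\mathsf{nat}}$; if $t\in \mathrm{NF}_\varepsilon$ with $\varepsilon\ne\mathsf{nat}$ then $\mathrm{succ}(t)$ and $\mathrm{if}(t,s,x.u)$ are in $\mathrm{NF}_{\mathsf{stuck}}$; if $t\in \mathrm{NF}_\varepsilon$, $s\in \mathrm{NF}_{\varepsilon'}$ and $\varepsilon\neq\mathsf{abs}$ then $t\,s\in \mathrm{NF}_{\mathsf{stuck}}$. The natures $\mathsf{abs}$ and $\mathsf{nat}$ are called proper. **Types.** With $[\dots]$ denoting finite multisets, possibly empty: abs-types $A ::= M\to T$; nat-types $N ::= 0\mid \mathrm{S}(\mathcal N)$; optional multitypes $M::=\bot\mid T$; multitypes $T ::= [A_1,\dots,A_n]_{\mathsf{abs}}\mid \mathcal N$, where $\mathcal N::=[N_1,\dots,N_n]_{\mathsf{nat}}$. The subscript is the nature of the multitype. Multitypes of the same nature are compatible and are added as multisets; $\bot$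 is compatible with everything and neutral for the sum. Subsumption $M\lhd T$ holds exactly for $\bot\lhd[\,]_\nu$ and $T\lhd T$. A family context $\Phi$ maps variables to finite multisets of multitypes, a typing context $\Gamma$ maps variables to optional multitypes, both with finite support; contexts are added pointwise, typing contexts only when they are compatible at every variable (all sums below are required to be defined). A multi-counter $m$ is a finite multiset of rule names, of cardinality $|m|$. **System $\mathcal H$.** Judgments $\Phi;\Gamma\vdash^m t:T$ are derived by the following rules, with $I$ any finite index set, possibly empty. By the bound-variable convention, the bound variable $x$ of the subject of a conclusion lies in neither of the contexts written $\Phi,\Phi_i$ and $\Gamma,\Gamma_i$. * $\emptyset;x:T\vdash^{[\,]}x:T$, and $x:[T];\emptyset\vdash^{[\,]}x:T$. * If $\Phi_i;\Gamma_i,x:M_i\vdash^{m_i}t:S_i$ for all $i\in I$, then $\sum_i\Phi_i;\sum_i\Gamma_i\vdash^{\sum_i m_i}\lambda x.t:[M_i\to S_i]_{i\in I}$, of nature $\mathsf{abs}$. * If $\Phi_1;\Gamma_1\vdash^{m_1}t:[M\to S]_{\mathsf{abs}}$, $M\lhd T$ and $\Phi_2;\Gamma_2\vdash^{m_2}s:T$,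 then $\Phi_1+\Phi_2;\Gamma_1+\Gamma_2\vdash^{[B]+m_1+m_2}t\,s:S$. * $\emptyset;\emptyset\vdash^{[\,]}\mathbf{0}:[0,\dots,0]_{\mathsf{nat}}$, with any number $n\ge0$ of entries. * If $\Phi;\Gamma\vdash^m t:\mathcal N$ and $\mathcal N=\sum_{i\in I}\mathcal N_i$ (with $\mathcal N=[\,]_{\mathsf{nat}}$ for $I=\emptyset$), then $\Phi;\Gamma\vdash^m\mathrm{succ}(t):[\mathrm{S}(\mathcal N_i)]_{i\in I}$, of nature $\mathsf{nat}$. * If $\Phi_1;\Gamma_1\vdash^{m_1}t:[0]_{\mathsf{nat}}$ and $\Phi_2;\Gamma_2\vdash^{m_2}s:T$, then $\Phi_1+\Phi_2;\Gamma_1+\Gamma_2\vdash^{[I0]+m_1+m_2}\mathrm{if}(t,s,x.u):T$. * If $\Phi_1;\Gamma_1\vdash^{m_1}t:[\mathrm{S}(\mathcal N)]_{\mathsf{nat}}$, $M\lhd\mathcal N$ and $\Phi_2;\Gamma_2,x:M\vdash^{m_2}u:T$, then $\Phi_1+\Phi_2;\Gamma_1+\Gamma_2\vdash^{[IS]+m_1+m_2}\mathrm{if}(t,s,x.u):T$.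 * If $\Phi,x:[T_i]_{i\in I};\Gamma\vdash^m t:S$ and $\Phi_i;\Gamma_i\vdash^{m_i}\mathrm{fix}\,x.t:T_i$ for all $i\in I$, then $\Phi+\sum_i\Phi_i;\Gamma+\sum_i\Gamma_i\vdash^{[F]+m+\sum_i m_i}\mathrm{fix}\,x.t:S$. **Theorem (Soundness and Completeness of System $\mathcal H$ with Upper Bounds).** Let $t$ be a closed term and let $\nu\in\{\mathsf{abs},\mathsf{nat}\}$. 1. (Soundness) Whenever $\Phi;\Gamma\vdash^m t:T$ with $T$ a multitype of nature $\nu$, there is a reduction sequence $t=t_0\to_{\rho_1}t_1\to\cdots\to_{\rho_n}t_n$ with $t_n\in \mathrm{NF}_\nu$ and $n\le|m|$. 2. (Completeness) Whenever there is a reduction sequence $t=t_0\to_{\rho_1}t_1\to\cdots\to_{\rho_n}t_n$ with $t_n\in \mathrm{NF}_\nu$, there are $\Phi,\Gamma,m$ and a multitype $T$ of nature $\nu$ such that $\Phi;\Gamma\vdash^m t:T$ and $n\le|m|$; moreover $m$ can be chosen with $|m|=n$. Consequently, for every $k\in\mathbb N$, $t$ is typable in $\mathcal H$ by a multitype of nature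 $\nu$ with a multi-counter of size at most $k$ if and only if $t$ reduces to a normal form in $\mathrm{NF}_\nu$ in at most $k$ steps. -/

import Mathlib

open scoped BigOperators

namespace PCFH

/-! ## Terms, in de Bruijn notation

Terms up to renaming of bound variables are represented by de Bruijn terms: the variable `n` refers
to the `n`-th enclosing binder, counted from `0` and from the inside; free variables are the indices
which exceed the number of enclosing binders. -/

/-- Terms. The binders are `lam t` and `fix t`, which bind one variable in `t`, and `ifz t s u`
(in named notation: `if(t, s, x. u)`), which binds one variable in `u`. -/
inductive Term : Type
  | var : ℕ → Term
  | lam : Term → Term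
  | app : Term → Term → Term
  | zero : Term
  | succ : Term → Term
  | ifz : Term → Term → Term → Term
  | fix : Term → Term

/-- All free variables of the term are among the first `k` indices. -/
def Term.ClosedAt : ℕ → Term → Prop
  | k, .var n => n < k
  | k, .lam t => t.ClosedAt (k + 1)
  | k, .app t s => t.ClosedAt k ∧ s.ClosedAt k
  | _, .zero => True
  | k, .succ t => t.ClosedAt k
  | k, .ifz t s u => t.ClosedAt k ∧ s.ClosedAt k ∧ u.ClosedAt (k + 1)
  | k, .fix t => t.ClosedAt (k + 1)

/-- A term is closed if it has no free variables. -/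
def Term.Closed (t : Term) : Prop := t.ClosedAt 0

/-- Extension of a sequence by a new entry at index `0`. -/
def cons {α : Type} (a : α) (f : ℕ → α) : ℕ → α
  | 0 => a
  | n + 1 => f n

/-- Renaming of the free variables. -/
def Term.rename : (ℕ → ℕ) → Term → Term
  | r, .var n => .var (r n)
  | r, .lam t => .lam (t.rename (cons 0 (fun n => r n + 1)))
  | r, .app t s => .app (t.rename r) (s.rename r)
  | _, .zero => .zero
  | r, .succ t => .succ (t.rename r)
  | r, .ifz t s u => .ifz (t.rename r) (s.rename r) (u.rename (cons 0 (fun n => r n + 1)))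
  | r, .fix t => .fix (t.rename (cons 0 (fun n => r n + 1)))

/-- The substitution `σ`, pushed under a binder. -/
def liftSubst (σ : ℕ → Term) : ℕ → Term :=
  cons (.var 0) (fun n => (σ n).rename Nat.succ)

/-- Simultaneous capture-avoiding substitution. -/
def Term.subst : (ℕ → Term) → Term → Term
  | σ, .var n => σ n
  | σ, .lam t => .lam (t.subst (liftSubst σ))
  | σ, .app t s => .app (t.subst σ) (s.subst σ)
  | _, .zero => .zero
  | σ, .succ t => .succ (t.subst σ)
  | σ, .ifz t s u => .ifz (t.subst σ) (s.subst σ) (u.subst (liftSubst σ))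
  | σ, .fix t => .fix (t.subst (liftSubst σ))

/-- `t.inst s` is the body `t` of a binder with the bound variable replaced by `s`. -/
def Term.inst (t s : Term) : Term := t.subst (cons s .var)

/-! ## Values, reduction, normal forms -/

/-- Natural values `0`, `succ 0`, `succ (succ 0)`, ... -/
inductive NatValue : Term → Prop
  | zero : NatValue .zero
  | succ {k : Term} : NatValue k → NatValue (.succ k)

/-- Values: abstractions and natural values. -/
inductive Value : Term → Prop
  | lam (t : Term) : Value (.lam t)
  | nat {k : Term} : NatValue k → Value k

/-- Names of the reduction rules. -/
inductive Rule : Type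
  | beta
  | ifZero
  | ifSucc
  | fix

/-- One step of reduction, labelled by the name of the rule that is applied. -/
inductive Step : Rule → Term → Term → Prop
  | beta (t : Term) {v : Term} : Value v → Step .beta (.app (.lam t) v) (t.inst v)
  | ifZero (t s : Term) : Step .ifZero (.ifz .zero t s) t
  | ifSucc {k : Term} (t s : Term) : NatValue k →
      Step .ifSucc (.ifz (.succ k) t s) (s.inst k)
  | fix (t : Term) : Step .fix (.fix t) (t.inst (.fix t))
  | appL {ρ : Rule} {t t' : Term} (s : Term) : Step ρ t t' → Step ρ (.app t s) (.app t' s)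
  | appR {ρ : Rule} (t : Term) {s s' : Term} : Step ρ s s' → Step ρ (.app t s) (.app t s')
  | succ {ρ : Rule} {t t' : Term} : Step ρ t t' → Step ρ (.succ t) (.succ t')
  | ifz {ρ : Rule} {t t' : Term} (s u : Term) :
      Step ρ t t' → Step ρ (.ifz t s u) (.ifz t' s u)

/-- `Steps t [ρ₁, ..., ρₙ] t'`: there is a reduction sequence
`t = t₀ → t₁ → ... → tₙ = t'` whose `i`-th step applies the rule `ρᵢ`. -/
inductive Steps : Term → List Rule → Term → Prop
  | refl (t : Term) : Steps t [] t
  | step {ρ : Rule} {t t' t'' : Term} {ρs : List Rule} :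
      Step ρ t t' → Steps t' ρs t'' → Steps t (ρ :: ρs) t''

/-- Proper natures. -/
inductive Nature : Type
  | abs
  | nat

/-- Fallible natures. -/
inductive FallibleNature : Type
  | abs
  | nat
  | stuck

/-- A proper nature, seen as a fallible nature. -/
def Nature.toFallible : Nature → FallibleNature
  | .abs => .abs
  | .nat => .nat

/-- `NF ε t`: the term `t` is a normal form of nature `ε`. -/
inductive NF : FallibleNature → Term → Prop
  | abs (t : Term) : NF .abs (.lam t)
  | app {ε ε' : FallibleNature} {t s : Term} :
      NF ε t → NF ε' s → ε ≠ .abs → NF .stuck (.app t s)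
  | zero : NF .nat .zero
  | succNat {t : Term} : NF .nat t → NF .nat (.succ t)
  | succStuck {ε : FallibleNature} {t : Term} : NF ε t → ε ≠ .nat → NF .stuck (.succ t)
  | ifz {ε : FallibleNature} {t : Term} (s u : Term) :
      NF ε t → ε ≠ .nat → NF .stuck (.ifz t s u)

/-! ## Types

The grammar of types is

* abs-types `A ::= M → T`, nat-types `N ::= 0 | S(nat-multitype)`,
* optional multitypes `M ::= ⊥ | T`,
* multitypes `T ::= [A₁, ..., Aₙ]_abs | [N₁, ..., Nₙ]_nat`,

with brackets denoting finite multisets. As Lean's inductive types cannot be nested through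
`Multiset`, nat-types and abs-types are built as the least fixed points `QPF.Fix` of the
functors that the grammar describes. That these functors are quotients of polynomial functors,
as `QPF.Fix` requires, is shown by means of their finitary presentation. -/

/-- A functor is a quotient of a polynomial functor if each `x : G α` involves only finitely many
elements of `α`. -/
noncomputable abbrev finitaryQPF (G : Type → Type) [Functor G] [LawfulFunctor G]
    (h : ∀ (α : Type) (x : G α), ∃ (k : ℕ) (a : G (Fin k)) (f : Fin k → α), f <$> a = x) :
    QPF.{0, 0, 0} G where
  P := ⟨Σ k : ℕ, G (Fin k), fun a => Fin a.1⟩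
  abs p := p.2 <$> p.1.2
  repr x := ⟨⟨(h _ x).choose, (h _ x).choose_spec.choose⟩,
    (h _ x).choose_spec.choose_spec.choose⟩
  abs_repr x := (h _ x).choose_spec.choose_spec.choose_spec
  abs_map f p := LawfulFunctor.comp_map p.2 f p.1.2

theorem exists_fin_map_eq {α : Type} (s : Multiset α) :
    ∃ (k : ℕ) (a : Multiset (Fin k)) (f : Fin k → α), a.map f = s := by
  induction s using Quotient.inductionOn with
  | _ l =>
    refine ⟨l.length, (List.finRange l.length : Multiset (Fin l.length)), l.get, ?_⟩
    simp

/-- Shape of nat-types over a set `X` of nat-types: `0` or `S[N₁, ..., Nₙ]`. -/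
inductive NatShape (X : Type) : Type
  | zero : NatShape X
  | succ : Multiset X → NatShape X

instance : Functor NatShape where
  map f
    | .zero => .zero
    | .succ N => .succ (N.map f)

instance : LawfulFunctor NatShape where
  map_const := rfl
  id_map x := by cases x <;> simp [Functor.map]
  comp_map f g x := by cases x <;> simp [Functor.map]

noncomputable instance : QPF NatShape := finitaryQPF NatShape (by
  rintro α (_ | N)
  · exact ⟨0, .zero, Fin.elim0, rfl⟩
  · obtain ⟨k, a, f, h⟩ := exists_fin_map_eq N
    exact ⟨k, .succ a, f, congrArg NatShape.succ h⟩)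

/-- nat-types. -/
def NatTy : Type := QPF.Fix NatShape

/-- The nat-type `0`. -/
noncomputable def NatTy.zero : NatTy := QPF.Fix.mk NatShape.zero

/-- The nat-type `S[N₁, ..., Nₙ]`. -/
noncomputable def NatTy.succ (N : Multiset NatTy) : NatTy := QPF.Fix.mk (NatShape.succ N)

/-- Multitypes over a set `X` of abs-types. -/
inductive MultitypeOf (X : Type) : Type
  | abs : Multiset X → MultitypeOf X
  | nat : Multiset NatTy → MultitypeOf X

/-- Optional multitypes over a set `X` of abs-types. -/
inductive OptMultitypeOf (X : Type) : Type
  | bot : OptMultitypeOf X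
  | some : MultitypeOf X → OptMultitypeOf X

def MultitypeOf.map {X Y : Type} (f : X → Y) : MultitypeOf X → MultitypeOf Y
  | .abs A => .abs (A.map f)
  | .nat N => .nat N

def OptMultitypeOf.map {X Y : Type} (f : X → Y) : OptMultitypeOf X → OptMultitypeOf Y
  | .bot => .bot
  | .some T => .some (T.map f)

/-- Shape of abs-types over a set `X` of abs-types: `M → T`. -/
structure AbsShape (X : Type) : Type where
  dom : OptMultitypeOf X
  cod : MultitypeOf X

instance : Functor AbsShape where
  map f A := ⟨A.dom.map f, A.cod.map f⟩

instance : LawfulFunctor AbsShape where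
  map_const := rfl
  id_map := by
    rintro α ⟨_ | _ | _, _ | _⟩ <;>
      simp [Functor.map, OptMultitypeOf.map, MultitypeOf.map]
  comp_map := by
    rintro α β γ f g ⟨_ | _ | _, _ | _⟩ <;>
      simp [Functor.map, OptMultitypeOf.map, MultitypeOf.map]

noncomputable instance : QPF AbsShape := finitaryQPF AbsShape (by
  have hT : ∀ (α : Type) (T : MultitypeOf α), ∃ (k : ℕ) (a : MultitypeOf (Fin k))
      (f : Fin k → α), a.map f = T := by
    rintro α (A | N)
    · obtain ⟨k, a, f, h⟩ := exists_fin_map_eq A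
      exact ⟨k, .abs a, f, congrArg MultitypeOf.abs h⟩
    · exact ⟨0, .nat N, Fin.elim0, rfl⟩
  have hM : ∀ (α : Type) (M : OptMultitypeOf α), ∃ (k : ℕ) (a : OptMultitypeOf (Fin k))
      (f : Fin k → α), a.map f = M := by
    rintro α (_ | T)
    · exact ⟨0, .bot, Fin.elim0, rfl⟩
    · obtain ⟨k, a, f, h⟩ := hT α T
      exact ⟨k, .some a, f, congrArg OptMultitypeOf.some h⟩
  have cT : ∀ {α β γ : Type} (f : α → β) (g : β → γ) (T : MultitypeOf α),
      (T.map f).map g = T.map (g ∘ f) := by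
    rintro α β γ f g (_ | _) <;> simp [MultitypeOf.map]
  have cM : ∀ {α β γ : Type} (f : α → β) (g : β → γ) (M : OptMultitypeOf α),
      (M.map f).map g = M.map (g ∘ f) := by
    rintro α β γ f g (_ | _) <;> simp [OptMultitypeOf.map, cT]
  rintro α ⟨M, T⟩
  obtain ⟨k, a, f, rfl⟩ := hM α M
  obtain ⟨l, b, g, rfl⟩ := hT α T
  refine ⟨k + l, ⟨a.map (Fin.castAdd l), b.map (Fin.natAdd k)⟩, Fin.append f g, ?_⟩
  have h₁ : Fin.append f g ∘ Fin.castAdd l = f := by ext i; simp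
  have h₂ : Fin.append f g ∘ Fin.natAdd k = g := by ext i; simp
  simp only [Functor.map, cM, cT, h₁, h₂])

/-- abs-types. -/
def AbsTy : Type := QPF.Fix AbsShape

/-- Multitypes `[A₁, ..., Aₙ]_abs` and `[N₁, ..., Nₙ]_nat`. -/
abbrev Multitype : Type := MultitypeOf AbsTy

/-- Optional multitypes: `⊥` or a multitype. -/
abbrev OptMultitype : Type := OptMultitypeOf AbsTy

/-- The abs-type `M → T`. -/
noncomputable def AbsTy.arrow (M : OptMultitype) (T : Multitype) : AbsTy :=
  QPF.Fix.mk (AbsShape.mk M T)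

/-- Every nat-type has exactly one of the two forms given by the grammar, in exactly one way. -/
theorem NatTy.zero_ne_succ (N : Multiset NatTy) : NatTy.zero ≠ NatTy.succ N := fun h => by
  have := congrArg QPF.Fix.dest h
  simp [NatTy.zero, NatTy.succ, QPF.Fix.dest_mk] at this

theorem NatTy.succ_injective : Function.Injective NatTy.succ := fun N N' h => by
  have := congrArg QPF.Fix.dest h
  simp only [NatTy.succ, QPF.Fix.dest_mk] at this
  exact NatShape.succ.inj this

theorem NatTy.eq_zero_or_succ (n : NatTy) : n = NatTy.zero ∨ ∃ N, n = NatTy.succ N := by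
  rw [← QPF.Fix.mk_dest (F := NatShape) n]
  rcases QPF.Fix.dest (F := NatShape) n with _ | N
  · exact Or.inl rfl
  · exact Or.inr ⟨N, rfl⟩

/-- Every abs-type is an arrow, in exactly one way. -/
theorem AbsTy.arrow_inj {M M' : OptMultitype} {T T' : Multitype} :
    AbsTy.arrow M T = AbsTy.arrow M' T' ↔ M = M' ∧ T = T' := by
  refine ⟨fun h => ?_, fun ⟨h, h'⟩ => by rw [h, h']⟩
  have := congrArg QPF.Fix.dest h
  simp only [AbsTy.arrow, QPF.Fix.dest_mk] at this
  exact AbsShape.mk.inj this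

theorem AbsTy.exists_eq_arrow (A : AbsTy) : ∃ M T, A = AbsTy.arrow M T :=
  ⟨(QPF.Fix.dest (F := AbsShape) A).dom, (QPF.Fix.dest (F := AbsShape) A).cod,
    (QPF.Fix.mk_dest (F := AbsShape) A).symm⟩

/-- The nature of a multitype. -/
def Multitype.nature : Multitype → Nature
  | .abs _ => .abs
  | .nat _ => .nat

/-- Two optional multitypes are compatible if one of them is `⊥` or if both have the same
nature. -/
def OptMultitype.Compatible : OptMultitype → OptMultitype → Prop
  | .some T, .some S => Multitype.nature T = Multitype.nature S
  | _, _ => True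

/-- The sum of optional multitypes. It is meaningful for compatible arguments only, and used only
for these; an abs-multitype and a nat-multitype get the first of the two as their sum, by
convention, so that the operation is associative and commutative everywhere. -/
def OptMultitype.add : OptMultitype → OptMultitype → OptMultitype
  | .bot, M => M
  | M, .bot => M
  | .some (.abs A), .some (.abs B) => .some (.abs (A + B))
  | .some (.nat N), .some (.nat P) => .some (.nat (N + P))
  | .some (.abs A), .some (.nat _) => .some (.abs A)
  | .some (.nat _), .some (.abs B) => .some (.abs B)

instance : Zero OptMultitype := ⟨.bot⟩

instance : Add OptMultitype := ⟨OptMultitype.add⟩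

instance : AddCommMonoid OptMultitype where
  zero_add _ := rfl
  add_zero := by rintro (_ | _ | _) <;> rfl
  add_comm := by
    rintro (_ | _ | A) (_ | _ | B) <;> simp [HAdd.hAdd, Add.add, OptMultitype.add] <;>
      exact add_comm _ _
  add_assoc := by
    rintro (_ | _ | _) (_ | _ | _) (_ | _ | _) <;>
      simp [HAdd.hAdd, Add.add, OptMultitype.add] <;> exact add_assoc _ _ _
  nsmul := nsmulRec

/-- Subsumption: `⊥ ◁ []_ν` for both natures `ν`, and `T ◁ T`. -/
inductive Subsumes : OptMultitype → Multitype → Prop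
  | botAbs : Subsumes .bot (.abs 0)
  | botNat : Subsumes .bot (.nat 0)
  | refl (T : Multitype) : Subsumes (.some T) T

/-! ## Contexts

The contexts of a derivable judgment are everywhere `0` except at finitely many variables. -/

/-- Family contexts map variables to multitype families, that is, to multisets of multitypes. They
are added pointwise, and `0` is the empty family context. -/
abbrev FamCtx : Type := ℕ → Multiset Multitype

/-- Typing contexts map variables to optional multitypes. They are added pointwise, and `0` is
the empty typing context, constantly `⊥`. -/
abbrev TyCtx : Type := ℕ → OptMultitype

/-- Two typing contexts are compatible if they are so at each variable. -/
def TyCtx.Compatible (Γ Δ : TyCtx) : Prop := ∀ x, OptMultitype.Compatible (Γ x) (Δ x)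

/-- Multi-counters: multisets of rule names. -/
abbrev MultiCounter : Type := Multiset Rule

/-! ## The type system

`Typing m Φ Γ t T` is the judgment `Φ; Γ ⊢^m t : T`. The finite index sets are `Fin n`,
with `n = 0` allowed. In a premise about the body of a binder, the new variable `0` is assigned
`cons a Φ` in the family context and `cons b Γ` in the typing context: variables bound by `lam`
and `ifz` occur in typing contexts only, those bound by `fix` in family contexts only. Hence in
a derivation for a closed term no variable is ever in the domain of both contexts. -/
inductive Typing : MultiCounter → FamCtx → TyCtx → Term → Multitype → Prop
  | var₁ (x : ℕ) (T : Multitype) :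
      Typing 0 0 (Pi.single x (.some T)) (.var x) T
  | var₂ (x : ℕ) (T : Multitype) :
      Typing 0 (Pi.single x {T}) 0 (.var x) T
  | abs {t : Term} {n : ℕ} {m : Fin n → MultiCounter} {Φ : Fin n → FamCtx} {Γ : Fin n → TyCtx}
      {M : Fin n → OptMultitype} {S : Fin n → Multitype} :
      (∀ i, Typing (m i) (cons 0 (Φ i)) (cons (M i) (Γ i)) t (S i)) →
      (∀ i j, TyCtx.Compatible (Γ i) (Γ j)) →
      Typing (∑ i, m i) (∑ i, Φ i) (∑ i, Γ i) (.lam t)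
        (.abs (Finset.univ.val.map fun i => AbsTy.arrow (M i) (S i)))
  | app {t s : Term} {m₁ m₂ : MultiCounter} {Φ₁ Φ₂ : FamCtx} {Γ₁ Γ₂ : TyCtx}
      {M : OptMultitype} {S T : Multitype} :
      Typing m₁ Φ₁ Γ₁ t (.abs {AbsTy.arrow M S}) →
      Subsumes M T →
      Typing m₂ Φ₂ Γ₂ s T →
      TyCtx.Compatible Γ₁ Γ₂ →
      Typing ({.beta} + m₁ + m₂) (Φ₁ + Φ₂) (Γ₁ + Γ₂) (.app t s) S
  | zero (n : ℕ) :
      Typing 0 0 0 .zero (.nat (Multiset.replicate n NatTy.zero))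
  | succ {t : Term} {m : MultiCounter} {Φ : FamCtx} {Γ : TyCtx}
      {N : Multiset NatTy} {Ns : Multiset (Multiset NatTy)} :
      Typing m Φ Γ t (.nat N) →
      N = Ns.sum →
      Typing m Φ Γ (.succ t) (.nat (Ns.map NatTy.succ))
  | ifZero {t s u : Term} {m₁ m₂ : MultiCounter} {Φ₁ Φ₂ : FamCtx} {Γ₁ Γ₂ : TyCtx}
      {T : Multitype} :
      Typing m₁ Φ₁ Γ₁ t (.nat {NatTy.zero}) →
      Typing m₂ Φ₂ Γ₂ s T →
      TyCtx.Compatible Γ₁ Γ₂ →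
      Typing ({.ifZero} + m₁ + m₂) (Φ₁ + Φ₂) (Γ₁ + Γ₂) (.ifz t s u) T
  | ifSucc {t s u : Term} {m₁ m₂ : MultiCounter} {Φ₁ Φ₂ : FamCtx} {Γ₁ Γ₂ : TyCtx}
      {N : Multiset NatTy} {M : OptMultitype} {T : Multitype} :
      Typing m₁ Φ₁ Γ₁ t (.nat {NatTy.succ N}) →
      Subsumes M (.nat N) →
      Typing m₂ (cons 0 Φ₂) (cons M Γ₂) u T →
      TyCtx.Compatible Γ₁ Γ₂ →
      Typing ({.ifSucc} + m₁ + m₂) (Φ₁ + Φ₂) (Γ₁ + Γ₂) (.ifz t s u) T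
  | fix {t : Term} {m₀ : MultiCounter} {Φ₀ : FamCtx} {Γ₀ : TyCtx} {S : Multitype}
      {n : ℕ} {m : Fin n → MultiCounter} {Φ : Fin n → FamCtx} {Γ : Fin n → TyCtx}
      {T : Fin n → Multitype} :
      Typing m₀ (cons (Finset.univ.val.map T) Φ₀) (cons 0 Γ₀) t S →
      (∀ i, Typing (m i) (Φ i) (Γ i) (.fix t) (T i)) →
      (∀ i, TyCtx.Compatible Γ₀ (Γ i)) →
      (∀ i j, TyCtx.Compatible (Γ i) (Γ j)) →
      Typing ({.fix} + m₀ + ∑ i, m i) (Φ₀ + ∑ i, Φ i) (Γ₀ + ∑ i, Γ i) (.fix t) S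

end PCFH

namespace PCFH

/-! ## Closed terms and substitution of closed terms -/

namespace Term

/-! The core is an exact quantitative invariance, `Step.typing_iff`: for a closed `t` with a
`ρ`-step to `t'`, the typings of `t` are those of `t'` with the same type and one more `ρ` in the
counter. Read forwards, every step uses up one entry of the counter. Since a typable closed term
that is not yet a normal form of the right nature can step (`Typing.progress`), induction on the
size of the counter gives soundness. Read backwards, a normal form of proper nature is typed by an
empty multitype at cost zero, and each expansion adds one entry. This gives completeness, with
equality.

The invariance rests on a substitution lemma (`Typing.subst_single`) and its converse
(`Typing.antiSubst`). Two kinds of substitution occur: a value replaces a variable of the typing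
context, and a fixpoint replaces a variable of the family context. `Supply` axiomatizes what both
need: the available derivations of the substituted term can be split and merged along sums of
contexts, with additive counters. Values split because multitypes are multisets: a derivation for an
abstraction is a family of derivations of its body, and a numeral costs nothing. Fixpoints split
because each copy comes with its own derivation.

Only closed terms are ever substituted. Their contexts vanish (`Typing.ctx_eq_zero`), so no capture
arises and only the counters have to be tracked. -/

theorem ClosedAt.mono {t : Term} {k l : ℕ} (h : t.ClosedAt k) (hkl : k ≤ l) : t.ClosedAt l := by
  induction t generalizing k l with
  | var n => exact lt_of_lt_of_le h hkl
  | lam t ih => exact ih (k := k + 1) h (by omega)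
  | app t s iht ihs => exact ⟨iht h.1 hkl, ihs h.2 hkl⟩
  | zero => trivial
  | succ t ih => exact ih (k := k) h hkl
  | ifz t s u iht ihs ihu =>
    exact ⟨iht h.1 hkl, ihs h.2.1 hkl, ihu h.2.2 (by omega)⟩
  | fix t ih => exact ih (k := k + 1) h (by omega)

theorem ClosedAt.rename_eq {t : Term} {k : ℕ} (h : t.ClosedAt k) {r : ℕ → ℕ}
    (hr : ∀ n < k, r n = n) : t.rename r = t := by
  have lift : ∀ {k : ℕ} {r : ℕ → ℕ}, (∀ n < k, r n = n) →
      ∀ n < k + 1, cons 0 (fun n => r n + 1) n = n := by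
    rintro k r hr (_ | n) hn
    · rfl
    · simp [cons, hr n (by omega)]
  induction t generalizing k r with
  | var n => exact congrArg var (hr n h)
  | lam t ih => exact congrArg lam (ih (k := k + 1) h (lift hr))
  | app t s iht ihs => simp only [rename, iht h.1 hr, ihs h.2 hr]
  | zero => rfl
  | succ t ih => exact congrArg succ (ih (k := k) h hr)
  | ifz t s u iht ihs ihu =>
    simp only [rename, iht h.1 hr, ihs h.2.1 hr, ihu h.2.2 (lift hr)]
  | fix t ih => exact congrArg fix (ih (k := k + 1) h (lift hr))

theorem ClosedAt.subst_congr {t : Term} {k : ℕ} (h : t.ClosedAt k) {σ τ : ℕ → Term}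
    (hσ : ∀ n < k, σ n = τ n) : t.subst σ = t.subst τ := by
  have lift : ∀ {k : ℕ} {σ τ : ℕ → Term}, (∀ n < k, σ n = τ n) →
      ∀ n < k + 1, liftSubst σ n = liftSubst τ n := by
    rintro k σ τ hσ (_ | n) hn
    · rfl
    · simp [liftSubst, cons, hσ n (by omega)]
  induction t generalizing k σ τ with
  | var n => exact hσ n h
  | lam t ih => exact congrArg lam (ih (k := k + 1) h (lift hσ))
  | app t s iht ihs => simp only [subst, iht h.1 hσ, ihs h.2 hσ]
  | zero => rfl
  | succ t ih => exact congrArg succ (ih (k := k) h hσ)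
  | ifz t s u iht ihs ihu =>
    simp only [subst, iht h.1 hσ, ihs h.2.1 hσ, ihu h.2.2 (lift hσ)]
  | fix t ih => exact congrArg fix (ih (k := k + 1) h (lift hσ))

/-- The substitution of `u` for the variable `k`, which leaves the other variables unchanged. -/
def single (k : ℕ) (u : Term) (n : ℕ) : Term := if n = k then u else var n

/-- Renaming does not affect the closed term `u`, so pushing the substitution under a binder merely
shifts the index. -/
theorem liftSubst_single {u : Term} (hu : u.Closed) (k : ℕ) :
    liftSubst (single k u) = single (k + 1) u := by
  funext n
  rcases n with _ | n
  · simp [liftSubst, cons, single]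
  · by_cases h : n = k
    · simp [liftSubst, cons, single, h, ClosedAt.rename_eq hu]
    · simp [liftSubst, cons, single, h, rename]

/-- `inst` lowers the other indices and `single` keeps them, which makes no difference when only the
variable `0` may be free. The form with `single` is stable under binders and so suits induction. -/
theorem inst_eq_subst_single {t : Term} (ht : t.ClosedAt 1) (u : Term) :
    t.inst u = t.subst (single 0 u) := by
  refine ht.subst_congr fun n hn => ?_
  obtain rfl : n = 0 := by omega
  simp [cons, single]

theorem ClosedAt.subst_single {t u : Term} {k : ℕ} (ht : t.ClosedAt (k + 1)) (hu : u.Closed) :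
    (t.subst (single k u)).ClosedAt k := by
  induction t generalizing k with
  | var n =>
    by_cases h : n = k
    · simpa [subst, single, h] using hu.mono (Nat.zero_le k)
    · have : n < k + 1 := ht
      simp only [subst, single, h, if_false, ClosedAt]
      omega
  | lam t ih =>
    simp only [subst, liftSubst_single hu]
    exact ih (k := k + 1) ht
  | app t s iht ihs => exact ⟨iht ht.1, ihs ht.2⟩
  | zero => trivial
  | succ t ih => exact ih (k := k) ht
  | ifz t s u' iht ihs ihu =>
    refine ⟨iht ht.1, ihs ht.2.1, ?_⟩
    simpa only [liftSubst_single hu] using ihu ht.2.2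
  | fix t ih =>
    simp only [subst, liftSubst_single hu]
    exact ih (k := k + 1) ht

theorem ClosedAt.inst {t u : Term} (ht : t.ClosedAt 1) (hu : u.Closed) : (t.inst u).Closed := by
  rw [inst_eq_subst_single ht]
  exact ht.subst_single hu

end Term

theorem NatValue.closed {k : Term} (hk : NatValue k) : k.Closed := by
  induction hk with
  | zero => trivial
  | succ _ ih => exact ih

theorem Step.closed {ρ : Rule} {t t' : Term} (h : Step ρ t t') (ht : t.Closed) : t'.Closed := by
  induction h with
  | beta t _ => exact Term.ClosedAt.inst ht.1 ht.2
  | ifZero t s => exact ht.2.1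
  | ifSucc t s hk => exact Term.ClosedAt.inst ht.2.2 hk.closed
  | fix t => exact Term.ClosedAt.inst (u := .fix t) ht ht
  | appL s _ ih => exact ⟨ih ht.1, ht.2⟩
  | appR t _ ih => exact ⟨ht.1, ih ht.2⟩
  | succ _ ih => exact ih ht
  | ifz s u _ ih => exact ⟨ih ht.1, ht.2⟩

/-! ## Contexts -/

/-- The context `Φ` with the entry of `k` replaced by `0`. -/
def erase {α : Type} [AddCommMonoid α] (k : ℕ) : (ℕ → α) →+ (ℕ → α) where
  toFun Φ n := if n = k then 0 else Φ n
  map_zero' := by ext; simp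
  map_add' Φ Ψ := by
    funext n
    by_cases h : n = k <;> simp [h]

section

variable {α : Type} [AddCommMonoid α]

theorem erase_apply (k : ℕ) (Φ : ℕ → α) (n : ℕ) : erase k Φ n = if n = k then 0 else Φ n := rfl

theorem erase_cons (k : ℕ) (a : α) (Φ : ℕ → α) :
    erase (k + 1) (cons a Φ) = cons a (erase k Φ) := by
  funext n
  rcases n with _ | n <;> simp [erase_apply, cons]

theorem erase_single_self (k : ℕ) (a : α) : erase k (Pi.single k a) = 0 := by
  funext n
  by_cases h : n = k <;> simp [erase_apply, h]

theorem erase_single_of_ne {k l : ℕ} (h : l ≠ k) (a : α) :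
    erase k (Pi.single l a) = Pi.single l a := by
  funext n
  by_cases hn : n = k
  · subst hn; simp [erase_apply, Ne.symm h]
  · simp [erase_apply, hn]

/-- Erasing at `k + 1` does not touch the entry of the innermost bound variable. Hence a context
rebuilt for the body of a binder still has the shape that the typing rule asks for. -/
theorem exists_cons_of_erase_eq {k : ℕ} {a : α} {Ψ Φ : ℕ → α} (h : erase (k + 1) Ψ = cons a Φ) :
    ∃ Φ', Ψ = cons a Φ' ∧ erase k Φ' = Φ := by
  refine ⟨fun n => Ψ (n + 1), ?_, ?_⟩
  · funext n
    rcases n with _ | n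
    · simpa [erase_apply, cons] using congrFun h 0
    · rfl
  · funext n
    simpa [erase_apply, cons] using congrFun h (n + 1)

theorem cons_eq_single (a : α) : cons a 0 = Pi.single 0 a := by
  funext n; rcases n with _ | n <;> simp [cons]

end

namespace OptMultitype

theorem bot_eq_zero : (OptMultitypeOf.bot : OptMultitype) = 0 := rfl

theorem compatible_zero_left (M : OptMultitype) : Compatible 0 M := trivial

theorem compatible_zero_right (M : OptMultitype) : Compatible M 0 := by
  rcases M with _ | _ <;> trivial

theorem Compatible.add {M M₁ M₂ : OptMultitype} (h₁ : Compatible M M₁) (h₂ : Compatible M M₂) :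
    Compatible M (M₁ + M₂) := by
  rcases M with _ | _ | _ <;> rcases M₁ with _ | _ | _ <;> rcases M₂ with _ | _ | _ <;>
    trivial

theorem Compatible.sum {ι : Type} {s : Finset ι} {M : OptMultitype} {M' : ι → OptMultitype}
    (h : ∀ i ∈ s, Compatible M (M' i)) : Compatible M (∑ i ∈ s, M' i) := by
  classical
  induction s using Finset.induction_on with
  | empty => exact compatible_zero_right M
  | insert a s ha ih =>
    rw [Finset.sum_insert ha]
    exact (h a (by simp)).add (ih fun i hi => h i (by simp [hi]))

end OptMultitype

theorem TyCtx.Compatible.erase {Γ Δ : TyCtx} (h : TyCtx.Compatible Γ Δ) (k : ℕ) :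
    TyCtx.Compatible (PCFH.erase k Γ) (PCFH.erase k Δ) := fun n => by
  by_cases hn : n = k
  · simp only [erase_apply, hn, if_true]; trivial
  · simpa only [erase_apply, hn, if_false] using h n

theorem TyCtx.Compatible.of_erase {Γ Δ : TyCtx} {k : ℕ}
    (h : TyCtx.Compatible (PCFH.erase k Γ) (PCFH.erase k Δ))
    (hk : OptMultitype.Compatible (Γ k) (Δ k)) : TyCtx.Compatible Γ Δ := fun n => by
  by_cases hn : n = k
  · rwa [hn]
  · simpa only [erase_apply, hn, if_false] using h n

theorem TyCtx.compatible_zero : TyCtx.Compatible 0 0 := fun _ => trivial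

/-- A derivable judgment assigns `0` to the variables that are not free in the subject. -/
theorem Typing.ctx_eq_zero {m : MultiCounter} {Φ : FamCtx} {Γ : TyCtx} {t : Term} {T : Multitype}
    (h : Typing m Φ Γ t T) {k : ℕ} (ht : t.ClosedAt k) {n : ℕ} (hn : k ≤ n) :
    Φ n = 0 ∧ Γ n = 0 := by
  induction h generalizing k n with
  | var₁ x T | var₂ x T =>
    have hx : x < k := ht
    have : n ≠ x := by omega
    simp [this]
  | abs _ _ ih =>
    have := fun i => ih i (k := k + 1) ht (n := n + 1) (by omega)
    simp only [cons] at this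
    simp [this]
  | app _ _ _ _ ih₁ ih₂ => simp [ih₁ ht.1 hn, ih₂ ht.2 hn]
  | zero => simp
  | succ _ _ ih => exact ih (k := k) ht hn
  | ifZero _ _ _ ih₁ ih₂ => simp [ih₁ ht.1 hn, ih₂ ht.2.1 hn]
  | ifSucc _ _ _ _ ih₁ ih₂ =>
    have := ih₂ ht.2.2 (n := n + 1) (by omega)
    simp only [cons] at this
    simp [ih₁ ht.1 hn, this]
  | fix _ _ _ _ ih₀ ih =>
    have h₀ := ih₀ (k := k + 1) ht (n := n + 1) (by omega)
    have := fun i => ih i (k := k) ht hn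
    simp only [cons] at h₀
    simp [h₀, this]

theorem Typing.ctx_eq_zero_of_closed {m : MultiCounter} {Φ : FamCtx} {Γ : TyCtx} {t : Term}
    {T : Multitype} (h : Typing m Φ Γ t T) (ht : t.Closed) : Φ = 0 ∧ Γ = 0 :=
  ⟨funext fun n => (h.ctx_eq_zero ht (Nat.zero_le n)).1,
    funext fun n => (h.ctx_eq_zero ht (Nat.zero_le n)).2⟩

theorem Typing.congr {m m' : MultiCounter} {Φ Φ' : FamCtx} {Γ Γ' : TyCtx} {t : Term}
    {T : Multitype} (h : Typing m Φ Γ t T) (hm : m = m') (hΦ : Φ = Φ') (hΓ : Γ = Γ') :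
    Typing m' Φ' Γ' t T := by
  subst hm hΦ hΓ; exact h

/-! ## The substitution lemma and its converse -/

/-- `P m F M` expresses that the closed term `u` can be typed, with the multi-counter `m` in total,
by the multitypes of the family `F` and by the optional multitype `M`. -/
structure Supply (u : Term) (P : MultiCounter → Multiset Multitype → OptMultitype → Prop) :
    Prop where
  zero_iff : ∀ {m}, P m 0 0 ↔ m = 0
  split : ∀ {m F F' M M'}, OptMultitype.Compatible M M' → P m (F + F') (M + M') →
    ∃ m₁ m₂, m = m₁ + m₂ ∧ P m₁ F M ∧ P m₂ F' M'
  add : ∀ {m m' F F' M M'}, P m F M → P m' F' M' → P (m + m') (F + F') (M + M')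
  compatible : ∀ {m m' F F' M M'}, P m F M → P m' F' M' → OptMultitype.Compatible M M'
  typing_of_fam : ∀ {m T}, P m {T} 0 → Typing m 0 0 u T
  typing_of_some : ∀ {m T}, P m 0 (.some T) → Typing m 0 0 u T
  of_typing : ∀ {m T}, Typing m 0 0 u T → P m {T} 0 ∨ P m 0 (.some T)

namespace Supply

variable {u : Term} {P : MultiCounter → Multiset Multitype → OptMultitype → Prop}

theorem split_sum (hP : Supply u P) : ∀ {n : ℕ} {m : MultiCounter}
    {F : Fin n → Multiset Multitype} {M : Fin n → OptMultitype},
    (∀ i j, OptMultitype.Compatible (M i) (M j)) → P m (∑ i, F i) (∑ i, M i) →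
    ∃ m' : Fin n → MultiCounter, m = ∑ i, m' i ∧ ∀ i, P (m' i) (F i) (M i)
  | 0, m, F, M, _, h => by
    simp only [Finset.univ_eq_empty, Finset.sum_empty, hP.zero_iff] at h
    exact ⟨fun _ => 0, by simp [h], fun i => i.elim0⟩
  | n + 1, m, F, M, hM, h => by
    rw [Fin.sum_univ_succ, Fin.sum_univ_succ] at h
    obtain ⟨m₁, m₂, rfl, h₁, h₂⟩ := hP.split (OptMultitype.Compatible.sum fun i _ => hM _ _) h
    obtain ⟨m', rfl, h'⟩ := hP.split_sum (fun i j => hM _ _) h₂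
    refine ⟨Fin.cons m₁ m', by simp [Fin.sum_univ_succ], fun i => ?_⟩
    refine Fin.cases ?_ (fun i => ?_) i
    · simpa using h₁
    · simpa using h' i

theorem sum (hP : Supply u P) {n : ℕ} {m : Fin n → MultiCounter}
    {F : Fin n → Multiset Multitype} {M : Fin n → OptMultitype}
    (h : ∀ i, P (m i) (F i) (M i)) : P (∑ i, m i) (∑ i, F i) (∑ i, M i) := by
  induction n with
  | zero => simpa using hP.zero_iff.2 rfl
  | succ n ih =>
    simp only [Fin.sum_univ_succ]
    exact hP.add (h 0) (ih fun i => h i.succ)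

end Supply

/-- The supply is split among the premises just as the rule splits its contexts, until each leaf at
`k` receives the one derivation of `u` that it needs; the counters therefore add up exactly. The
induction is on the derivation, since premises of the `fix` rule repeat its subject. -/
theorem Typing.subst_single {u : Term}
    {P : MultiCounter → Multiset Multitype → OptMultitype → Prop}
    (hu : u.Closed) (hP : Supply u P) {m m' : MultiCounter} {Φ : FamCtx} {Γ : TyCtx} {t : Term}
    {T : Multitype} (h : Typing m Φ Γ t T) {k : ℕ} (hk : P m' (Φ k) (Γ k)) :
    Typing (m + m') (erase k Φ) (erase k Γ) (t.subst (.single k u)) T := by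
  induction h generalizing k m' with
  | var₁ x T =>
    by_cases hx : x = k
    · subst hx
      simp only [Pi.zero_apply, Pi.single_eq_same] at hk
      simpa [Term.subst, Term.single, erase_single_self] using hP.typing_of_some hk
    · simp only [Pi.zero_apply, Pi.single_eq_of_ne (Ne.symm hx), hP.zero_iff] at hk
      simpa [Term.subst, Term.single, hx, hk, erase_single_of_ne hx] using Typing.var₁ x T
  | var₂ x T =>
    by_cases hx : x = k
    · subst hx
      simp only [Pi.zero_apply, Pi.single_eq_same] at hk
      simpa [Term.subst, Term.single, erase_single_self] using hP.typing_of_fam hk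
    · simp only [Pi.zero_apply, Pi.single_eq_of_ne (Ne.symm hx), hP.zero_iff] at hk
      simpa [Term.subst, Term.single, hx, hk, erase_single_of_ne hx] using Typing.var₂ x T
  | @abs t n m Φ Γ M S h hc ih =>
    rw [Finset.sum_apply, Finset.sum_apply] at hk
    obtain ⟨m', rfl, hm'⟩ := hP.split_sum (fun i j => hc i j k) hk
    have key := fun i => ih i (k := k + 1) (hm' i)
    simp only [erase_cons, ← Term.liftSubst_single hu] at key
    exact (Typing.abs key fun i j => (hc i j).erase k).congr Finset.sum_add_distrib
      (map_sum _ _ _).symm (map_sum _ _ _).symm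
  | app _ hs _ hc ih₁ ih₂ =>
    obtain ⟨m₁, m₂, rfl, h₁, h₂⟩ := hP.split (hc k) hk
    exact (Typing.app (ih₁ h₁) hs (ih₂ h₂) (hc.erase k)).congr (by abel)
      (map_add _ _ _).symm (map_add _ _ _).symm
  | zero n =>
    rw [Pi.zero_apply, Pi.zero_apply, hP.zero_iff] at hk
    exact (Typing.zero n).congr (by simp [hk]) (map_zero _).symm (map_zero _).symm
  | succ _ hN ih => exact Typing.succ (ih hk) hN
  | ifZero _ _ hc ih₁ ih₂ =>
    obtain ⟨m₁, m₂, rfl, h₁, h₂⟩ := hP.split (hc k) hk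
    exact (Typing.ifZero (ih₁ h₁) (ih₂ h₂) (hc.erase k)).congr (by abel)
      (map_add _ _ _).symm (map_add _ _ _).symm
  | ifSucc _ hs _ hc ih₁ ih₂ =>
    obtain ⟨m₁, m₂, rfl, h₁, h₂⟩ := hP.split (hc k) hk
    have key := ih₂ (k := k + 1) h₂
    simp only [erase_cons, ← Term.liftSubst_single hu] at key
    exact (Typing.ifSucc (ih₁ h₁) hs key (hc.erase k)).congr (by abel)
      (map_add _ _ _).symm (map_add _ _ _).symm
  | @fix t m₀ Φ₀ Γ₀ S n m Φ Γ T _ _ hc₀ hc ih₀ ih =>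
    rw [Pi.add_apply, Pi.add_apply, Finset.sum_apply, Finset.sum_apply] at hk
    obtain ⟨m₁, m₂, rfl, h₁, h₂⟩ :=
      hP.split (OptMultitype.Compatible.sum fun i _ => hc₀ i k) hk
    obtain ⟨m', rfl, hm'⟩ := hP.split_sum (fun i j => hc i j k) h₂
    have key₀ := ih₀ (k := k + 1) h₁
    have key := fun i => ih i (hm' i)
    simp only [erase_cons, ← Term.liftSubst_single hu] at key₀
    refine (Typing.fix key₀ key (fun i => (hc₀ i).erase k) fun i j => (hc i j).erase k).congr
      ?_ ?_ ?_
    · rw [Finset.sum_add_distrib]; abel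
    · rw [map_add, map_sum]
    · rw [map_add, map_sum]

/-- The conclusion of the converse of the substitution lemma. -/
def AntiSubst (P : MultiCounter → Multiset Multitype → OptMultitype → Prop) (k : ℕ)
    (m : MultiCounter) (Φ : FamCtx) (Γ : TyCtx) (t : Term) (T : Multitype) : Prop :=
  ∃ m₁ m₂ Φ' Γ', m = m₁ + m₂ ∧ erase k Φ' = Φ ∧ erase k Γ' = Γ ∧
    Typing m₁ Φ' Γ' t T ∧ P m₂ (Φ' k) (Γ' k)

/-- The supply decides which context records the occurrence: a family entry calls for `var₂`, an
optional multitype for `var₁`. -/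
theorem Typing.antiSubst_var {u : Term}
    {P : MultiCounter → Multiset Multitype → OptMultitype → Prop}
    (hu : u.Closed) (hP : Supply u P) {m : MultiCounter} {Φ : FamCtx} {Γ : TyCtx}
    {T : Multitype} (h : Typing m Φ Γ u T) (k : ℕ) : AntiSubst P k m Φ Γ (.var k) T := by
  obtain ⟨rfl, rfl⟩ := h.ctx_eq_zero_of_closed hu
  rcases hP.of_typing h with h | h
  · exact ⟨0, m, Pi.single k {T}, 0, (zero_add m).symm, erase_single_self _ _, map_zero _,
      .var₂ k T, by simpa using h⟩
  · exact ⟨0, m, 0, Pi.single k (.some T), (zero_add m).symm, map_zero _, erase_single_self _ _,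
      .var₁ k T, by simpa using h⟩

/-- Away from the substituted variable, `t` and `s` have the same head constructor, so the last rule
can be replayed on `t` while the derivations of `u` found in the premises are merged into one
supply. The rebuilt contexts must also be compatible at `k`; `Supply.compatible` provides this. -/
theorem Typing.antiSubst {u : Term}
    {P : MultiCounter → Multiset Multitype → OptMultitype → Prop}
    (hu : u.Closed) (hP : Supply u P) {m : MultiCounter} {Φ : FamCtx} {Γ : TyCtx} {t s : Term}
    {T : Multitype} (h : Typing m Φ Γ s T) {k : ℕ} (hs : s = t.subst (.single k u)) :
    AntiSubst P k m Φ Γ t T := by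
  -- In this case the derivation is one of `u` and may end with any rule, so it is settled before
  -- the case analysis on rules.
  by_cases ht : t = .var k
  · subst ht
    obtain rfl : s = u := by simpa [Term.subst, Term.single] using hs
    exact h.antiSubst_var hu hP k
  have hvar : ∀ {k x : ℕ}, ¬ Term.var x = .var k → Term.single k u x = .var x := by
    intro k x hx
    simp only [Term.var.injEq] at hx
    simp [Term.single, hx]
  -- The induction hypotheses inherit the assumption that the term is not the variable `k`; this
  -- removes it.
  have recur : ∀ {k : ℕ} {m : MultiCounter} {Φ : FamCtx} {Γ : TyCtx} {t s : Term} {T : Multitype},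
      Typing m Φ Γ s T → s = t.subst (.single k u) →
      (¬ t = .var k → AntiSubst P k m Φ Γ t T) → AntiSubst P k m Φ Γ t T := by
    intro k m Φ Γ t s T h hs ih
    by_cases ht : t = .var k
    · subst ht
      obtain rfl : s = u := by simpa [Term.subst, Term.single] using hs
      exact h.antiSubst_var hu hP k
    · exact ih ht
  induction h generalizing t k with
  | var₁ x T =>
    rcases t with y | _ | _ | _ | _ | _ | _ <;> simp only [Term.subst, reduceCtorEq] at hs
    rw [hvar ht] at hs
    cases hs
    refine ⟨0, 0, 0, Pi.single x (.some T), rfl, map_zero _, erase_single_of_ne ?_ _,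
      .var₁ x T, ?_⟩
    · simpa using ht
    · rw [Pi.single_eq_of_ne (by simpa [eq_comm] using ht)]
      exact hP.zero_iff.2 rfl
  | var₂ x T =>
    rcases t with y | _ | _ | _ | _ | _ | _ <;> simp only [Term.subst, reduceCtorEq] at hs
    rw [hvar ht] at hs
    cases hs
    refine ⟨0, 0, Pi.single x {T}, 0, rfl, erase_single_of_ne ?_ _, map_zero _,
      .var₂ x T, ?_⟩
    · simpa using ht
    · rw [Pi.single_eq_of_ne (by simpa [eq_comm] using ht)]
      exact hP.zero_iff.2 rfl
  | @abs s n m Φ Γ M S h hc ih =>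
    rcases t with y | t | _ | _ | _ | _ | _ <;>
      simp only [Term.subst, reduceCtorEq, Term.lam.injEq] at hs
    · rw [hvar ht] at hs; cases hs
    rw [Term.liftSubst_single hu] at hs
    choose m₁ m₂ Φ' Γ' hm hΦ hΓ h' hP' using fun i => recur (h i) hs (ih i hs)
    choose Φ₁ hΦ₁ hΦ₁' using fun i => exists_cons_of_erase_eq (hΦ i)
    choose Γ₁ hΓ₁ hΓ₁' using fun i => exists_cons_of_erase_eq (hΓ i)
    simp only [hΦ₁, hΓ₁] at h' hP'
    refine ⟨∑ i, m₁ i, ∑ i, m₂ i, ∑ i, Φ₁ i, ∑ i, Γ₁ i, ?_, ?_, ?_, Typing.abs h' ?_, ?_⟩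
    · simp only [hm, Finset.sum_add_distrib]
    · simp only [map_sum, hΦ₁']
    · simp only [map_sum, hΓ₁']
    · intro i j
      refine .of_erase (k := k) ?_ (hP.compatible (hP' i) (hP' j))
      simpa only [hΓ₁'] using hc i j
    · rw [Finset.sum_apply, Finset.sum_apply]
      exact hP.sum hP'
  | app h₁ hS h₂ hc ih₁ ih₂ =>
    rcases t with y | _ | ⟨t₁, t₂⟩ | _ | _ | _ | _ <;>
      simp only [Term.subst, reduceCtorEq, Term.app.injEq] at hs
    · rw [hvar ht] at hs; cases hs
    obtain ⟨m₁, m₁', Φ₁, Γ₁, rfl, rfl, rfl, h₁', hP₁⟩ := recur h₁ hs.1 (ih₁ hs.1)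
    obtain ⟨m₂, m₂', Φ₂, Γ₂, rfl, rfl, rfl, h₂', hP₂⟩ := recur h₂ hs.2 (ih₂ hs.2)
    exact ⟨_, m₁' + m₂', _, _, by abel, map_add _ _ _, map_add _ _ _,
      Typing.app h₁' hS h₂' (hc.of_erase (hP.compatible hP₁ hP₂)), hP.add hP₁ hP₂⟩
  | zero n =>
    rcases t with y | _ | _ | _ | _ | _ | _ <;> simp only [Term.subst, reduceCtorEq] at hs
    · rw [hvar ht] at hs; cases hs
    exact ⟨0, 0, 0, 0, rfl, map_zero _, map_zero _, .zero n, hP.zero_iff.2 rfl⟩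
  | succ h hN ih =>
    rcases t with y | _ | _ | _ | t | _ | _ <;>
      simp only [Term.subst, reduceCtorEq, Term.succ.injEq] at hs
    · rw [hvar ht] at hs; cases hs
    obtain ⟨m₁, m₁', Φ₁, Γ₁, rfl, rfl, rfl, h', hP'⟩ := recur h hs (ih hs)
    exact ⟨_, _, _, _, rfl, rfl, rfl, h'.succ hN, hP'⟩
  | ifZero h₁ h₂ hc ih₁ ih₂ =>
    rcases t with y | _ | _ | _ | _ | ⟨t₁, t₂, t₃⟩ | _ <;>
      simp only [Term.subst, reduceCtorEq, Term.ifz.injEq] at hs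
    · rw [hvar ht] at hs; cases hs
    obtain ⟨m₁, m₁', Φ₁, Γ₁, rfl, rfl, rfl, h₁', hP₁⟩ := recur h₁ hs.1 (ih₁ hs.1)
    obtain ⟨m₂, m₂', Φ₂, Γ₂, rfl, rfl, rfl, h₂', hP₂⟩ := recur h₂ hs.2.1 (ih₂ hs.2.1)
    exact ⟨_, m₁' + m₂', _, _, by abel, map_add _ _ _, map_add _ _ _,
      Typing.ifZero h₁' h₂' (hc.of_erase (hP.compatible hP₁ hP₂)), hP.add hP₁ hP₂⟩
  | ifSucc h₁ hS h₂ hc ih₁ ih₂ =>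
    rcases t with y | _ | _ | _ | _ | ⟨t₁, t₂, t₃⟩ | _ <;>
      simp only [Term.subst, reduceCtorEq, Term.ifz.injEq] at hs
    · rw [hvar ht] at hs; cases hs
    rw [Term.liftSubst_single hu] at hs
    obtain ⟨m₁, m₁', Φ₁, Γ₁, rfl, rfl, rfl, h₁', hP₁⟩ := recur h₁ hs.1 (ih₁ hs.1)
    obtain ⟨m₂, m₂', Φ₂, Γ₂, rfl, hΦ, hΓ, h₂', hP₂⟩ := recur h₂ hs.2.2 (ih₂ hs.2.2)
    obtain ⟨Φ₂, rfl, rfl⟩ := exists_cons_of_erase_eq hΦ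
    obtain ⟨Γ₂, rfl, rfl⟩ := exists_cons_of_erase_eq hΓ
    exact ⟨_, m₁' + m₂', _, _, by abel, map_add _ _ _, map_add _ _ _,
      Typing.ifSucc h₁' hS h₂' (hc.of_erase (hP.compatible hP₁ hP₂)), hP.add hP₁ hP₂⟩
  | @fix s m₀ Φ₀ Γ₀ S n m Φ Γ T h₀ h hc₀ hc ih₀ ih =>
    rcases t with y | _ | _ | _ | _ | _ | t <;>
      simp only [Term.subst, reduceCtorEq, Term.fix.injEq] at hs
    · rw [hvar ht] at hs; cases hs
    -- The recursive premises type the whole fixpoint, outside the binder, so they need the equation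
    -- at index `k` rather than `k + 1`.
    have hs' : Term.fix s = (Term.fix t).subst (.single k u) := congrArg Term.fix hs
    rw [Term.liftSubst_single hu] at hs
    obtain ⟨m₀, m₀', Φ₀, Γ₀, rfl, hΦ, hΓ, h₀', hP₀⟩ := recur h₀ hs (ih₀ hs)
    obtain ⟨Φ₀, rfl, rfl⟩ := exists_cons_of_erase_eq hΦ
    obtain ⟨Γ₀, rfl, rfl⟩ := exists_cons_of_erase_eq hΓ
    choose m₁ m₂ Φ' Γ' hm hΦ hΓ h' hP' using fun i => recur (h i) hs' (ih i hs')
    refine ⟨_, m₀' + ∑ i, m₂ i, _, _, ?_, ?_, ?_, Typing.fix h₀' h' (fun i => ?_) fun i j => ?_, ?_⟩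
    · simp only [hm, Finset.sum_add_distrib]; abel
    · simp only [map_add, map_sum, hΦ]
    · simp only [map_add, map_sum, hΓ]
    · refine .of_erase (k := k) ?_ (hP.compatible hP₀ (hP' i))
      simpa only [hΓ] using hc₀ i
    · refine .of_erase (k := k) ?_ (hP.compatible (hP' i) (hP' j))
      simpa only [hΓ] using hc i j
    · rw [Pi.add_apply, Pi.add_apply, Finset.sum_apply, Finset.sum_apply]
      exact hP.add hP₀ (hP.sum hP')

/-! ## Families of judgments -/

/-- `Family R m s`: the elements of the multiset `s` are related by `R` to multi-counters whose
sum is `m`. -/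
def Family {α : Type} (R : MultiCounter → α → Prop) (m : MultiCounter) (s : Multiset α) : Prop :=
  ∃ p : Multiset (MultiCounter × α),
    (p.map Prod.fst).sum = m ∧ p.map Prod.snd = s ∧ ∀ x ∈ p, R x.1 x.2

/-- Choosing a preimage in `p` for each element of `s`, one at a time, lifts the splitting of the
image. It serves to split families of derivations, and later the decompositions in the `succ` rule.
-/
theorem exists_add_of_map_eq_add {α β : Type} (f : α → β) {p : Multiset α} {s s' : Multiset β}
    (h : p.map f = s + s') : ∃ q q', p = q + q' ∧ q.map f = s ∧ q'.map f = s' := by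
  induction s using Multiset.induction_on generalizing p with
  | empty => exact ⟨0, p, (zero_add p).symm, rfl, by simpa using h⟩
  | cons b s ih =>
    rw [Multiset.cons_add] at h
    obtain ⟨a, ha, rfl⟩ : ∃ a ∈ p, f a = b := by
      rw [← Multiset.mem_map, h]; exact Multiset.mem_cons_self _ _
    obtain ⟨p, rfl⟩ := Multiset.exists_cons_of_mem ha
    rw [Multiset.map_cons, Multiset.cons_inj_right] at h
    obtain ⟨q, q', rfl, rfl, rfl⟩ := ih h
    exact ⟨a ::ₘ q, q', by rw [Multiset.cons_add], by simp, rfl⟩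

namespace Family

variable {α : Type} {R : MultiCounter → α → Prop}

theorem zero_iff {m : MultiCounter} : Family R m 0 ↔ m = 0 := by
  constructor
  · rintro ⟨p, rfl, hp, -⟩
    rw [Multiset.map_eq_zero] at hp
    simp [hp]
  · rintro rfl
    exact ⟨0, by simp⟩

theorem singleton_iff {m : MultiCounter} {a : α} : Family R m {a} ↔ R m a := by
  constructor
  · rintro ⟨p, rfl, hp, h⟩
    obtain ⟨x, rfl, rfl⟩ := Multiset.map_eq_singleton.1 hp
    simpa using h x
  · exact fun h => ⟨{(m, a)}, by simp, by simp, by simpa using h⟩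

theorem add {m m' : MultiCounter} {s s' : Multiset α} (h : Family R m s) (h' : Family R m' s') :
    Family R (m + m') (s + s') := by
  obtain ⟨p, rfl, rfl, h⟩ := h
  obtain ⟨p', rfl, rfl, h'⟩ := h'
  refine ⟨p + p', by simp, by simp, fun x hx => ?_⟩
  rcases Multiset.mem_add.1 hx with hx | hx
  exacts [h x hx, h' x hx]

theorem split {m : MultiCounter} {s s' : Multiset α} (h : Family R m (s + s')) :
    ∃ m₁ m₂, m = m₁ + m₂ ∧ Family R m₁ s ∧ Family R m₂ s' := by
  obtain ⟨p, rfl, hp, h⟩ := h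
  obtain ⟨q, q', rfl, hq, hq'⟩ := exists_add_of_map_eq_add _ hp
  exact ⟨_, _, by rw [Multiset.map_add, Multiset.sum_add],
    ⟨q, rfl, hq, fun x hx => h x (Multiset.mem_add.2 (.inl hx))⟩,
    ⟨q', rfl, hq', fun x hx => h x (Multiset.mem_add.2 (.inr hx))⟩⟩

/-- The typing rules number their premises, while splitting and merging are natural for unordered
families; enumerating the multiset by a list passes between the two. -/
theorem iff_fin {m : MultiCounter} {s : Multiset α} :
    Family R m s ↔ ∃ (n : ℕ) (m' : Fin n → MultiCounter) (a : Fin n → α),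
      m = ∑ i, m' i ∧ s = Finset.univ.val.map a ∧ ∀ i, R (m' i) (a i) := by
  constructor
  · rintro ⟨p, rfl, rfl, h⟩
    induction p using Quotient.inductionOn with
    | _ l =>
      refine ⟨l.length, fun i => (l.get i).1, fun i => (l.get i).2, ?_, ?_, fun i => ?_⟩
      · rw [← List.sum_ofFn, ← Function.comp_def Prod.fst, ← List.map_ofFn, List.ofFn_get]
        rfl
      · rw [Fin.univ_val_map, ← Function.comp_def Prod.snd, ← List.map_ofFn, List.ofFn_get]
        rfl
      · exact h _ (by simp)
  · rintro ⟨n, m', a, rfl, rfl, h⟩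
    refine ⟨Finset.univ.val.map fun i => (m' i, a i), ?_, ?_, ?_⟩
    · rw [Multiset.map_map]; rfl
    · rw [Multiset.map_map]; rfl
    · simpa using h

end Family

/-! ## Typing of closed terms -/

theorem typing_lam_iff {m : MultiCounter} {t : Term} (ht : t.ClosedAt 1) {T : Multitype} :
    Typing m 0 0 (.lam t) T ↔ ∃ A, T = .abs A ∧
      Family (fun m A => ∃ M S, A = AbsTy.arrow M S ∧ Typing m (cons 0 0) (cons M 0) t S) m A := by
  constructor
  -- The contexts in the conclusions of the rules are sums, which cannot be unified with `0`; hence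
  -- they are generalized before inversion, here and in the lemmas below.
  · suffices ∀ {Φ Γ}, Typing m Φ Γ (.lam t) T → ∃ A, T = .abs A ∧
        Family (fun m A => ∃ M S, A = AbsTy.arrow M S ∧ Typing m (cons 0 0) (cons M 0) t S) m A from
      fun h => this h
    intro Φ Γ h
    cases h with
    | @abs _ n m Φ Γ M S h hc =>
      refine ⟨_, rfl, Family.iff_fin.2 ⟨n, m, _, rfl, rfl, fun i => ⟨M i, S i, rfl, ?_⟩⟩⟩
      have h0 := fun k => (h i).ctx_eq_zero ht (n := k + 1) (by omega)
      refine (h i).congr rfl ?_ ?_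
      · congr 1; exact funext fun k => (h0 k).1
      · congr 1; exact funext fun k => (h0 k).2
  · rintro ⟨A, rfl, h⟩
    obtain ⟨n, m', A, rfl, rfl, hA⟩ := Family.iff_fin.1 h
    choose M S hA h' using hA
    obtain rfl : A = fun i => AbsTy.arrow (M i) (S i) := funext hA
    exact (Typing.abs (Φ := fun _ => 0) (Γ := fun _ => 0) h' fun _ _ _ => trivial).congr rfl
      (by simp) (by simp)

theorem typing_app_iff {m : MultiCounter} {t s : Term} (ht : t.Closed) (hs : s.Closed)
    {S : Multitype} :
    Typing m 0 0 (.app t s) S ↔ ∃ m₁ m₂ M T, m = {.beta} + m₁ + m₂ ∧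
      Typing m₁ 0 0 t (.abs {AbsTy.arrow M S}) ∧ Subsumes M T ∧ Typing m₂ 0 0 s T := by
  constructor
  · suffices ∀ {Φ Γ}, Typing m Φ Γ (.app t s) S → ∃ m₁ m₂ M T, m = {.beta} + m₁ + m₂ ∧
        Typing m₁ 0 0 t (.abs {AbsTy.arrow M S}) ∧ Subsumes M T ∧ Typing m₂ 0 0 s T from
      fun h => this h
    intro Φ Γ h
    cases h with
    | app h₁ hS h₂ _ =>
      obtain ⟨rfl, rfl⟩ := h₁.ctx_eq_zero_of_closed ht
      obtain ⟨rfl, rfl⟩ := h₂.ctx_eq_zero_of_closed hs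
      exact ⟨_, _, _, _, rfl, h₁, hS, h₂⟩
  · rintro ⟨m₁, m₂, M, T, rfl, h₁, hS, h₂⟩
    exact (Typing.app h₁ hS h₂ TyCtx.compatible_zero).congr rfl (add_zero 0) (add_zero 0)

theorem typing_zero_iff {m : MultiCounter} {T : Multitype} :
    Typing m 0 0 .zero T ↔ m = 0 ∧ ∃ n, T = .nat (Multiset.replicate n NatTy.zero) := by
  constructor
  · suffices ∀ {Φ Γ}, Typing m Φ Γ .zero T →
        m = 0 ∧ ∃ n, T = .nat (Multiset.replicate n NatTy.zero) from fun h => this h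
    intro Φ Γ h
    cases h
    exact ⟨rfl, _, rfl⟩
  · rintro ⟨rfl, n, rfl⟩
    exact .zero n

theorem typing_succ_iff {m : MultiCounter} {t : Term} {T : Multitype} :
    Typing m 0 0 (.succ t) T ↔ ∃ Ns : Multiset (Multiset NatTy),
      T = .nat (Ns.map NatTy.succ) ∧ Typing m 0 0 t (.nat Ns.sum) := by
  constructor
  · suffices ∀ {Φ Γ}, Typing m Φ Γ (.succ t) T → ∃ Ns : Multiset (Multiset NatTy),
        T = .nat (Ns.map NatTy.succ) ∧ Typing m Φ Γ t (.nat Ns.sum) from fun h => this h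
    intro Φ Γ h
    cases h with
    | succ h hN => subst hN; exact ⟨_, rfl, h⟩
  · rintro ⟨Ns, rfl, h⟩
    exact h.succ rfl

theorem typing_ifz_iff {m : MultiCounter} {t s u : Term} (h : (Term.ifz t s u).Closed)
    {T : Multitype} :
    Typing m 0 0 (.ifz t s u) T ↔
      (∃ m₁ m₂, m = {.ifZero} + m₁ + m₂ ∧ Typing m₁ 0 0 t (.nat {NatTy.zero}) ∧
        Typing m₂ 0 0 s T) ∨
      ∃ m₁ m₂ N M, m = {.ifSucc} + m₁ + m₂ ∧ Typing m₁ 0 0 t (.nat {NatTy.succ N}) ∧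
        Subsumes M (.nat N) ∧ Typing m₂ (cons 0 0) (cons M 0) u T := by
  obtain ⟨ht, hs, hu⟩ := h
  constructor
  · suffices ∀ {Φ Γ}, Typing m Φ Γ (.ifz t s u) T →
        (∃ m₁ m₂, m = {.ifZero} + m₁ + m₂ ∧ Typing m₁ 0 0 t (.nat {NatTy.zero}) ∧
          Typing m₂ 0 0 s T) ∨
        ∃ m₁ m₂ N M, m = {.ifSucc} + m₁ + m₂ ∧ Typing m₁ 0 0 t (.nat {NatTy.succ N}) ∧
          Subsumes M (.nat N) ∧ Typing m₂ (cons 0 0) (cons M 0) u T from fun h => this h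
    intro Φ Γ h
    cases h with
    | ifZero h₁ h₂ _ =>
      obtain ⟨rfl, rfl⟩ := h₁.ctx_eq_zero_of_closed ht
      obtain ⟨rfl, rfl⟩ := h₂.ctx_eq_zero_of_closed hs
      exact .inl ⟨_, _, rfl, h₁, h₂⟩
    | ifSucc h₁ hS h₂ _ =>
      obtain ⟨rfl, rfl⟩ := h₁.ctx_eq_zero_of_closed ht
      have h0 := fun k => h₂.ctx_eq_zero hu (n := k + 1) (by omega)
      refine .inr ⟨_, _, _, _, rfl, h₁, hS, h₂.congr rfl ?_ ?_⟩
      · congr 1; exact funext fun k => (h0 k).1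
      · congr 1; exact funext fun k => (h0 k).2
  · rintro (⟨m₁, m₂, rfl, h₁, h₂⟩ | ⟨m₁, m₂, N, M, rfl, h₁, hS, h₂⟩)
    · exact (Typing.ifZero h₁ h₂ TyCtx.compatible_zero).congr rfl (add_zero 0) (add_zero 0)
    · exact (Typing.ifSucc h₁ hS h₂ TyCtx.compatible_zero).congr rfl (add_zero 0) (add_zero 0)

theorem typing_fix_iff {m : MultiCounter} {t : Term} (ht : t.ClosedAt 1) {S : Multitype} :
    Typing m 0 0 (.fix t) S ↔ ∃ m₁ m₂ F, m = {.fix} + m₁ + m₂ ∧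
      Typing m₁ (cons F 0) (cons 0 0) t S ∧
      Family (fun m T => Typing m 0 0 (.fix t) T) m₂ F := by
  constructor
  · suffices ∀ {Φ Γ}, Typing m Φ Γ (.fix t) S → ∃ m₁ m₂ F, m = {.fix} + m₁ + m₂ ∧
        Typing m₁ (cons F 0) (cons 0 0) t S ∧
        Family (fun m T => Typing m 0 0 (.fix t) T) m₂ F from fun h => this h
    intro Φ Γ h
    cases h with
    | @fix _ m₀ Φ₀ Γ₀ _ n m Φ Γ T h₀ h _ _ =>
      have h0 := fun k => h₀.ctx_eq_zero ht (n := k + 1) (by omega)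
      refine ⟨_, _, _, rfl, h₀.congr rfl ?_ ?_,
        Family.iff_fin.2 ⟨n, m, T, rfl, rfl, fun i => ?_⟩⟩
      · congr 1; exact funext fun k => (h0 k).1
      · congr 1; exact funext fun k => (h0 k).2
      · have hi := (h i).ctx_eq_zero_of_closed ht
        exact (h i).congr rfl hi.1 hi.2
  · rintro ⟨m₁, m₂, F, rfl, h₁, h₂⟩
    obtain ⟨n, m', T, rfl, rfl, h⟩ := Family.iff_fin.1 h₂
    exact (Typing.fix (Φ := fun _ => 0) (Γ := fun _ => 0) h₁ h (fun _ _ => trivial)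
      fun _ _ _ => trivial).congr rfl (by simp) (by simp)

/-! ## Typing of values -/

/-- Only the rules for `zero` and `succ` apply to a numeral, and neither adds to the counter. -/
theorem NatValue.typing {k : Term} (hk : NatValue k) {m : MultiCounter} {T : Multitype}
    (h : Typing m 0 0 k T) : m = 0 ∧ ∃ N, T = .nat N := by
  induction hk generalizing T with
  | zero =>
    obtain ⟨rfl, n, rfl⟩ := typing_zero_iff.1 h
    exact ⟨rfl, _, rfl⟩
  | succ _ ih =>
    obtain ⟨Ns, rfl, h'⟩ := typing_succ_iff.1 h
    exact ⟨(ih h').1, _, rfl⟩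

theorem NatValue.typing_zero {k : Term} (hk : NatValue k) : Typing 0 0 0 k (.nat 0) := by
  induction hk with
  | zero => exact .zero 0
  | succ _ ih => exact Typing.succ (Ns := 0) ih rfl

/-- This is what the free decomposition in the `succ` rule is for: splitting the entries `S(N_i)`
splits the decomposition, and the premise is typed by the corresponding sums. -/
theorem NatValue.typing_add_iff {k : Term} (hk : NatValue k) {N N' : Multiset NatTy} :
    Typing 0 0 0 k (.nat (N + N')) ↔ Typing 0 0 0 k (.nat N) ∧ Typing 0 0 0 k (.nat N') := by
  induction hk generalizing N N' with
  | zero =>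
    simp only [typing_zero_iff, MultitypeOf.nat.injEq, true_and]
    constructor
    · rintro ⟨n, h⟩
      rw [Multiset.eq_replicate] at h
      exact ⟨⟨_, Multiset.eq_replicate.2 ⟨rfl, fun b hb => h.2 b (Multiset.mem_add.2 (.inl hb))⟩⟩,
        ⟨_, Multiset.eq_replicate.2 ⟨rfl, fun b hb => h.2 b (Multiset.mem_add.2 (.inr hb))⟩⟩⟩
    · rintro ⟨⟨n, rfl⟩, n', rfl⟩
      exact ⟨n + n', (Multiset.replicate_add _ _ _).symm⟩
  | succ _ ih =>
    simp only [typing_succ_iff, MultitypeOf.nat.injEq]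
    constructor
    · rintro ⟨Ns, h, h'⟩
      obtain ⟨Ns₁, Ns₂, rfl, rfl, rfl⟩ := exists_add_of_map_eq_add _ h.symm
      rw [Multiset.sum_add, ih] at h'
      exact ⟨⟨_, rfl, h'.1⟩, ⟨_, rfl, h'.2⟩⟩
    · rintro ⟨⟨Ns₁, rfl, h₁⟩, Ns₂, rfl, h₂⟩
      exact ⟨Ns₁ + Ns₂, (Multiset.map_add _ _ _).symm, by rw [Multiset.sum_add, ih]; exact ⟨h₁, h₂⟩⟩

theorem Value.typing_split {v : Term} (hv : Value v) (hc : v.Closed) {m : MultiCounter}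
    {T T₁ T₂ : Multitype} (hn : Multitype.nature T₁ = Multitype.nature T₂)
    (hT : OptMultitypeOf.some T = .some T₁ + .some T₂) (h : Typing m 0 0 v T) :
    ∃ m₁ m₂, m = m₁ + m₂ ∧ Typing m₁ 0 0 v T₁ ∧ Typing m₂ 0 0 v T₂ := by
  cases hv with
  | lam t =>
    obtain ⟨A, rfl, hA⟩ := (typing_lam_iff hc).1 h
    rcases T₁ with A₁ | N₁ <;> rcases T₂ with A₂ | N₂ <;> cases hT
    · obtain ⟨m₁, m₂, rfl, h₁, h₂⟩ := hA.split
      exact ⟨m₁, m₂, rfl, (typing_lam_iff hc).2 ⟨_, rfl, h₁⟩, (typing_lam_iff hc).2 ⟨_, rfl, h₂⟩⟩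
    -- For mixed natures the conventional sum is an abs-multitype, so only the hypothesis on natures
    -- rules these cases out.
    all_goals cases hn
  | nat hk =>
    obtain ⟨rfl, N, rfl⟩ := hk.typing h
    rcases T₁ with A₁ | N₁ <;> rcases T₂ with A₂ | N₂ <;> cases hT
    exact ⟨0, 0, rfl, hk.typing_add_iff.1 h⟩

theorem Value.nature_eq {v : Term} (hv : Value v) (hc : v.Closed) {m m' : MultiCounter}
    {T T' : Multitype} (h : Typing m 0 0 v T) (h' : Typing m' 0 0 v T') :
    Multitype.nature T = Multitype.nature T' := by
  cases hv with
  | lam t =>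
    obtain ⟨A, rfl, -⟩ := (typing_lam_iff hc).1 h
    obtain ⟨A', rfl, -⟩ := (typing_lam_iff hc).1 h'
    rfl
  | nat hk =>
    obtain ⟨-, N, rfl⟩ := hk.typing h
    obtain ⟨-, N', rfl⟩ := hk.typing h'
    rfl

theorem Value.typing_add {v : Term} (hv : Value v) (hc : v.Closed) {m₁ m₂ : MultiCounter}
    {T₁ T₂ : Multitype} (h₁ : Typing m₁ 0 0 v T₁) (h₂ : Typing m₂ 0 0 v T₂) :
    ∃ T, OptMultitypeOf.some T = .some T₁ + .some T₂ ∧ Typing (m₁ + m₂) 0 0 v T := by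
  cases hv with
  | lam t =>
    obtain ⟨A₁, rfl, h₁'⟩ := (typing_lam_iff hc).1 h₁
    obtain ⟨A₂, rfl, h₂'⟩ := (typing_lam_iff hc).1 h₂
    exact ⟨.abs (A₁ + A₂), rfl, (typing_lam_iff hc).2 ⟨_, rfl, h₁'.add h₂'⟩⟩
  | nat hk =>
    obtain ⟨rfl, N₁, rfl⟩ := hk.typing h₁
    obtain ⟨rfl, N₂, rfl⟩ := hk.typing h₂
    exact ⟨.nat (N₁ + N₂), rfl, hk.typing_add_iff.2 ⟨h₁, h₂⟩⟩

/-! ### Supplies given by values and by families of derivations -/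

/-- The typings of a value, by optional multitypes. -/
def ValueSupply (v : Term) (m : MultiCounter) (F : Multiset Multitype) (M : OptMultitype) : Prop :=
  F = 0 ∧ ((M = 0 ∧ m = 0) ∨ ∃ T, M = .some T ∧ Typing m 0 0 v T)

theorem Value.supply {v : Term} (hv : Value v) (hc : v.Closed) : Supply v (ValueSupply v) where
  zero_iff := by
    refine ⟨?_, fun h => ⟨rfl, .inl ⟨rfl, h⟩⟩⟩
    rintro ⟨-, ⟨-, h⟩ | ⟨T, h, -⟩⟩
    · exact h
    · cases h
  split := by
    rintro m F F' M M' hM ⟨hF, h⟩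
    obtain ⟨rfl, rfl⟩ := add_eq_zero.1 hF
    rcases M with _ | T₁
    · exact ⟨0, m, (zero_add m).symm, ⟨rfl, .inl ⟨rfl, rfl⟩⟩, rfl, by
        rwa [OptMultitype.bot_eq_zero, zero_add] at h⟩
    rcases M' with _ | T₂
    · exact ⟨m, 0, (add_zero m).symm, ⟨rfl, by
        rwa [OptMultitype.bot_eq_zero, add_zero] at h⟩, rfl, .inl ⟨rfl, rfl⟩⟩
    rcases h with ⟨h, -⟩ | ⟨T, hT, h⟩
    · rcases T₁ with _ | _ <;> rcases T₂ with _ | _ <;> cases h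
    · obtain ⟨m₁, m₂, rfl, h₁, h₂⟩ := hv.typing_split hc hM hT.symm h
      exact ⟨m₁, m₂, rfl, ⟨rfl, .inr ⟨_, rfl, h₁⟩⟩, rfl, .inr ⟨_, rfl, h₂⟩⟩
  add := by
    rintro m m' F F' M M' ⟨rfl, h⟩ ⟨rfl, h'⟩
    refine ⟨rfl, ?_⟩
    rcases h with ⟨rfl, rfl⟩ | ⟨T, rfl, h⟩
    · simpa only [zero_add] using h'
    rcases h' with ⟨rfl, rfl⟩ | ⟨T', rfl, h'⟩
    · exact .inr ⟨T, add_zero _, by rwa [add_zero]⟩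
    · obtain ⟨T'', hT, h''⟩ := hv.typing_add hc h h'
      exact .inr ⟨T'', hT.symm, h''⟩
  compatible := by
    rintro m m' F F' M M' ⟨-, ⟨rfl, -⟩ | ⟨T, rfl, h⟩⟩ ⟨-, ⟨rfl, -⟩ | ⟨T', rfl, h'⟩⟩
    · trivial
    · trivial
    · trivial
    · exact hv.nature_eq hc h h'
  typing_of_fam := by
    rintro m T ⟨h, -⟩
    simp at h
  typing_of_some := by
    rintro m T ⟨-, ⟨h, -⟩ | ⟨T', h, h'⟩⟩
    · cases h
    · cases h; exact h'
  of_typing h := .inr ⟨rfl, .inr ⟨_, rfl, h⟩⟩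

/-- A value typed by an empty multitype costs nothing, so no counter is lost when the body ignores
its argument and the domain is `⊥`. Conversely, every value has the empty multitype of its own
nature. -/
theorem Value.exists_subsumes_iff {v : Term} (hv : Value v) (hc : v.Closed) {m : MultiCounter}
    {M : OptMultitype} :
    ValueSupply v m 0 M ↔ ∃ T, Subsumes M T ∧ Typing m 0 0 v T := by
  constructor
  · rintro ⟨-, ⟨rfl, rfl⟩ | ⟨T, rfl, h⟩⟩
    · cases hv with
      | lam t => exact ⟨.abs 0, .botAbs, (typing_lam_iff hc).2 ⟨0, rfl, Family.zero_iff.2 rfl⟩⟩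
      | nat hk => exact ⟨.nat 0, .botNat, hk.typing_zero⟩
    · exact ⟨T, .refl T, h⟩
  · rintro ⟨T, hS, h⟩
    refine ⟨rfl, ?_⟩
    cases hS with
    | refl => exact .inr ⟨T, rfl, h⟩
    | botNat =>
      cases hv with
      | lam t => obtain ⟨A, hA, -⟩ := (typing_lam_iff hc).1 h; cases hA
      | nat hk => exact .inl ⟨rfl, (hk.typing h).1⟩
    | botAbs =>
      cases hv with
      | lam t =>
        obtain ⟨A, hA, h⟩ := (typing_lam_iff hc).1 h
        cases hA
        exact .inl ⟨rfl, Family.zero_iff.1 h⟩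
      | nat hk => obtain ⟨-, N, hN⟩ := hk.typing h; cases hN

/-- The typings of a term, by families of multitypes. -/
def FamilySupply (u : Term) (m : MultiCounter) (F : Multiset Multitype) (M : OptMultitype) :
    Prop :=
  M = 0 ∧ Family (fun m T => Typing m 0 0 u T) m F

/-- Neither closedness nor being a value matters here: each member of the family carries a whole
derivation of `u`, so splitting never cuts through one. -/
theorem familySupply (u : Term) : Supply u (FamilySupply u) where
  zero_iff := ⟨fun h => Family.zero_iff.1 h.2, fun h => ⟨rfl, Family.zero_iff.2 h⟩⟩
  split := by
    rintro m F F' M M' - ⟨hM, h⟩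
    obtain ⟨rfl, rfl⟩ : M = 0 ∧ M' = 0 := by
      rcases M with _ | _ | _ <;> rcases M' with _ | _ | _ <;> first | exact ⟨rfl, rfl⟩ | cases hM
    obtain ⟨m₁, m₂, rfl, h₁, h₂⟩ := h.split
    exact ⟨m₁, m₂, rfl, ⟨rfl, h₁⟩, rfl, h₂⟩
  add := by
    rintro m m' F F' M M' ⟨rfl, h⟩ ⟨rfl, h'⟩
    exact ⟨add_zero 0, h.add h'⟩
  compatible := by
    rintro m m' F F' M M' ⟨rfl, -⟩ -
    exact OptMultitype.compatible_zero_left M'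
  typing_of_fam h := Family.singleton_iff.1 h.2
  typing_of_some h := by cases h.1
  of_typing h := .inl ⟨rfl, Family.singleton_iff.2 h⟩

/-! ### Subject reduction and subject expansion -/

theorem typing_inst_iff {u : Term}
    {P : MultiCounter → Multiset Multitype → OptMultitype → Prop} (hu : u.Closed)
    (hP : Supply u P) {t : Term} (ht : t.ClosedAt 1) {m : MultiCounter} {T : Multitype} :
    Typing m 0 0 (t.inst u) T ↔
      ∃ m₁ m₂ F M, m = m₁ + m₂ ∧ Typing m₁ (cons F 0) (cons M 0) t T ∧ P m₂ F M := by
  rw [Term.inst_eq_subst_single ht]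
  constructor
  · intro h
    obtain ⟨m₁, m₂, Φ, Γ, rfl, -, -, h, hP⟩ := h.antiSubst hu hP rfl
    have h0 := fun k => h.ctx_eq_zero ht (n := k + 1) (by omega)
    refine ⟨m₁, m₂, Φ 0, Γ 0, rfl, h.congr rfl ?_ ?_, hP⟩ <;> funext k <;> rcases k with _ | k
    exacts [rfl, (h0 k).1, rfl, (h0 k).2]
  · rintro ⟨m₁, m₂, F, M, rfl, h, hF⟩
    refine (h.subst_single hu hP (k := 0) hF).congr rfl ?_ ?_
    · rw [cons_eq_single, erase_single_self]
    · rw [cons_eq_single, erase_single_self]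

/-- Quantitative subject reduction and subject expansion. -/
theorem Step.typing_iff {ρ : Rule} {t t' : Term} (h : Step ρ t t') (ht : t.Closed)
    {m : MultiCounter} {T : Multitype} :
    Typing m 0 0 t T ↔ ∃ m', m = {ρ} + m' ∧ Typing m' 0 0 t' T := by
  induction h generalizing m T with
  | @beta t v hv =>
    rw [typing_app_iff (t := .lam t) ht.1 ht.2]
    constructor
    · rintro ⟨m₁, m₂, M, S, rfl, h₁, hS, h₂⟩
      obtain ⟨A, hA, h₁⟩ := (typing_lam_iff ht.1).1 h₁
      cases hA
      obtain ⟨M', S', hM, h₁⟩ := Family.singleton_iff.1 h₁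
      obtain ⟨rfl, rfl⟩ := AbsTy.arrow_inj.1 hM
      exact ⟨m₁ + m₂, add_assoc _ _ _, (typing_inst_iff ht.2 (hv.supply ht.2) ht.1).2
        ⟨m₁, m₂, 0, M, rfl, h₁, (hv.exists_subsumes_iff ht.2).2 ⟨S, hS, h₂⟩⟩⟩
    · rintro ⟨m', rfl, h⟩
      obtain ⟨m₁, m₂, F, M, rfl, h₁, hF⟩ := (typing_inst_iff ht.2 (hv.supply ht.2) ht.1).1 h
      -- A value is supplied through the typing context only, so the bound variable has the empty
      -- family, as the rule for abstractions demands.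
      obtain rfl := hF.1
      obtain ⟨S, hS, h₂⟩ := (hv.exists_subsumes_iff ht.2).1 hF
      exact ⟨m₁, m₂, M, S, (add_assoc _ _ _).symm, (typing_lam_iff ht.1).2
        ⟨_, rfl, Family.singleton_iff.2 ⟨M, T, rfl, h₁⟩⟩, hS, h₂⟩
  | ifZero t s =>
    rw [typing_ifz_iff ht]
    constructor
    · rintro (⟨m₁, m₂, rfl, h₁, h₂⟩ | ⟨m₁, m₂, N, M, rfl, h₁, hS, h₂⟩)
      · obtain ⟨rfl, -⟩ := NatValue.zero.typing h₁
        exact ⟨m₂, by rw [add_zero], h₂⟩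
      · obtain ⟨-, n, hn⟩ := typing_zero_iff.1 h₁
        simp only [MultitypeOf.nat.injEq] at hn
        have := (Multiset.eq_replicate.1 hn).2 _ (Multiset.mem_singleton_self _)
        exact absurd this.symm (NatTy.zero_ne_succ N)
    · rintro ⟨m', rfl, h⟩
      exact .inl ⟨0, m', by rw [add_zero], .zero 1, h⟩
  | @ifSucc k t s hk =>
    have hv := Value.nat hk
    have hc := hk.closed
    rw [typing_ifz_iff ht]
    constructor
    · rintro (⟨m₁, m₂, rfl, h₁, h₂⟩ | ⟨m₁, m₂, N, M, rfl, h₁, hS, h₂⟩)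
      · obtain ⟨Ns, hN, -⟩ := typing_succ_iff.1 h₁
        simp only [MultitypeOf.nat.injEq] at hN
        obtain ⟨N, -, hN⟩ := Multiset.map_eq_singleton.1 hN.symm
        exact absurd hN.symm (NatTy.zero_ne_succ N)
      · obtain ⟨Ns, hN, hk'⟩ := typing_succ_iff.1 h₁
        simp only [MultitypeOf.nat.injEq] at hN
        obtain ⟨N', rfl, hN'⟩ := Multiset.map_eq_singleton.1 hN.symm
        obtain rfl := NatTy.succ_injective hN'
        rw [Multiset.sum_singleton] at hk'
        obtain ⟨rfl, -⟩ := hk.typing hk'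
        exact ⟨m₂, by rw [add_zero], (typing_inst_iff hc (hv.supply hc) ht.2.2).2
          ⟨m₂, 0, 0, M, (add_zero _).symm, h₂, (hv.exists_subsumes_iff hc).2 ⟨_, hS, hk'⟩⟩⟩
    · rintro ⟨m', rfl, h⟩
      obtain ⟨m₁, m₂, F, M, rfl, h₁, hF⟩ := (typing_inst_iff hc (hv.supply hc) ht.2.2).1 h
      obtain rfl := hF.1
      obtain ⟨S, hS, h₂⟩ := (hv.exists_subsumes_iff hc).1 hF
      obtain ⟨rfl, N, rfl⟩ := hk.typing h₂
      -- The scrutinee gets the type `[S(N)]` from the decomposition of `N` into one block, and as a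
      -- numeral it has counter zero.
      exact .inr ⟨0, m₁, N, M, by rw [add_zero, add_zero],
        Typing.succ (Ns := {N}) h₂ (Multiset.sum_singleton N).symm, hS, h₁⟩
  | fix t =>
    rw [typing_fix_iff ht]
    constructor
    · rintro ⟨m₁, m₂, F, rfl, h₁, h₂⟩
      exact ⟨m₁ + m₂, add_assoc _ _ _, (typing_inst_iff ht (familySupply _) ht).2
        ⟨m₁, m₂, F, 0, rfl, h₁, rfl, h₂⟩⟩
    · rintro ⟨m', rfl, h⟩
      obtain ⟨m₁, m₂, F, M, rfl, h₁, rfl, h₂⟩ := (typing_inst_iff ht (familySupply _) ht).1 h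
      exact ⟨m₁, m₂, F, (add_assoc _ _ _).symm, h₁, h₂⟩
  | @appL ρ t t' s h ih =>
    rw [typing_app_iff ht.1 ht.2]
    constructor
    · rintro ⟨m₁, m₂, M, S, rfl, h₁, hS, h₂⟩
      obtain ⟨m', rfl, h'⟩ := (ih ht.1).1 h₁
      exact ⟨_, by abel, (typing_app_iff (h.closed ht.1) ht.2).2 ⟨m', m₂, M, S, rfl, h', hS, h₂⟩⟩
    · rintro ⟨m', rfl, h'⟩
      obtain ⟨m₁, m₂, M, S, rfl, h₁, hS, h₂⟩ := (typing_app_iff (h.closed ht.1) ht.2).1 h'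
      exact ⟨{ρ} + m₁, m₂, M, S, by abel, (ih ht.1).2 ⟨m₁, rfl, h₁⟩, hS, h₂⟩
  | @appR ρ t s s' h ih =>
    rw [typing_app_iff ht.1 ht.2]
    constructor
    · rintro ⟨m₁, m₂, M, S, rfl, h₁, hS, h₂⟩
      obtain ⟨m', rfl, h'⟩ := (ih ht.2).1 h₂
      exact ⟨_, by abel, (typing_app_iff ht.1 (h.closed ht.2)).2 ⟨m₁, m', M, S, rfl, h₁, hS, h'⟩⟩
    · rintro ⟨m', rfl, h'⟩
      obtain ⟨m₁, m₂, M, S, rfl, h₁, hS, h₂⟩ := (typing_app_iff ht.1 (h.closed ht.2)).1 h'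
      exact ⟨m₁, {ρ} + m₂, M, S, by abel, h₁, hS, (ih ht.2).2 ⟨m₂, rfl, h₂⟩⟩
  | succ h ih =>
    simp only [typing_succ_iff, ih ht]
    constructor
    · rintro ⟨Ns, rfl, m', rfl, h'⟩
      exact ⟨m', rfl, Ns, rfl, h'⟩
    · rintro ⟨m', rfl, Ns, rfl, h'⟩
      exact ⟨Ns, rfl, m', rfl, h'⟩
  | @ifz ρ t t' s u h ih =>
    have ht' : (Term.ifz t' s u).Closed := ⟨h.closed ht.1, ht.2⟩
    rw [typing_ifz_iff ht]
    constructor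
    · rintro (⟨m₁, m₂, rfl, h₁, h₂⟩ | ⟨m₁, m₂, N, M, rfl, h₁, hS, h₂⟩)
      · obtain ⟨m', rfl, h'⟩ := (ih ht.1).1 h₁
        exact ⟨_, by abel, (typing_ifz_iff ht').2 (.inl ⟨m', m₂, rfl, h', h₂⟩)⟩
      · obtain ⟨m', rfl, h'⟩ := (ih ht.1).1 h₁
        exact ⟨_, by abel, (typing_ifz_iff ht').2 (.inr ⟨m', m₂, N, M, rfl, h', hS, h₂⟩)⟩
    · rintro ⟨m', rfl, h'⟩
      rcases (typing_ifz_iff ht').1 h' with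
        ⟨m₁, m₂, rfl, h₁, h₂⟩ | ⟨m₁, m₂, N, M, rfl, h₁, hS, h₂⟩
      · exact .inl ⟨{ρ} + m₁, m₂, by abel, (ih ht.1).2 ⟨m₁, rfl, h₁⟩, h₂⟩
      · exact .inr ⟨{ρ} + m₁, m₂, N, M, by abel, (ih ht.1).2 ⟨m₁, rfl, h₁⟩, hS, h₂⟩

/-! ## Normal forms and progress -/

theorem NF.natValue {t : Term} (h : NF .nat t) : NatValue t := by
  generalize hε : FallibleNature.nat = ε at h
  induction h with
  | zero => exact .zero
  | succNat _ ih => exact ih rfl |>.succ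
  | _ => cases hε

theorem NF.exists_eq_lam {t : Term} (h : NF .abs t) : ∃ s, t = .lam s := by
  cases h; exact ⟨_, rfl⟩

/-- A typable closed term is a normal form of the nature of its type, or it can be reduced. -/
theorem Typing.progress {m : MultiCounter} {t : Term} {T : Multitype} (h : Typing m 0 0 t T)
    (ht : t.Closed) : NF (Multitype.nature T).toFallible t ∨ ∃ ρ t', Step ρ t t' := by
  induction t generalizing m T with
  | var n => exact absurd ht (Nat.not_lt_zero n)
  | lam t _ =>
    obtain ⟨A, rfl, -⟩ := (typing_lam_iff ht).1 h
    exact .inl (.abs t)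
  | app t s iht ihs =>
    obtain ⟨m₁, m₂, M, S, rfl, h₁, -, h₂⟩ := (typing_app_iff ht.1 ht.2).1 h
    rcases iht h₁ ht.1 with hn | ⟨ρ, t', h'⟩
    · obtain ⟨t, rfl⟩ := hn.exists_eq_lam
      rcases ihs h₂ ht.2 with hn' | ⟨ρ, s', h'⟩
      -- The application rule types the argument even when the domain is `⊥`, so a normal argument
      -- has proper nature and is a value.
      · refine .inr ⟨_, _, .beta t ?_⟩
        rcases S with _ | _
        · obtain ⟨s, rfl⟩ := hn'.exists_eq_lam
          exact .lam s
        · exact .nat hn'.natValue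
      · exact .inr ⟨_, _, .appR _ h'⟩
    · exact .inr ⟨_, _, .appL _ h'⟩
  | zero =>
    obtain ⟨-, n, rfl⟩ := typing_zero_iff.1 h
    exact .inl .zero
  | succ t ih =>
    obtain ⟨Ns, rfl, hN⟩ := typing_succ_iff.1 h
    rcases ih hN ht with hn | ⟨ρ, t', h'⟩
    · exact .inl hn.succNat
    · exact .inr ⟨_, _, .succ h'⟩
  | ifz t s u iht _ _ =>
    -- Both rules for the conditional give the scrutinee a nat-multitype; its nature alone matters
    -- for progress.
    obtain ⟨m', N, h'⟩ : ∃ m' N, Typing m' 0 0 t (.nat N) := by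
      rcases (typing_ifz_iff ht).1 h with ⟨m₁, _, _, h₁, _⟩ | ⟨m₁, _, _, _, _, h₁, _⟩
      exacts [⟨_, _, h₁⟩, ⟨_, _, h₁⟩]
    rcases iht h' ht.1 with hn | ⟨ρ, t', h'⟩
    · cases hn.natValue with
      | zero => exact .inr ⟨_, _, .ifZero _ _⟩
      | succ hk => exact .inr ⟨_, _, .ifSucc _ _ hk⟩
    · exact .inr ⟨_, _, .ifz _ _ h'⟩
  | fix t _ => exact .inr ⟨_, _, .fix t⟩

/-! ### Soundness and completeness -/

theorem NF.exists_typing {ν : Nature} {t : Term} (h : NF ν.toFallible t) (ht : t.Closed) :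
    ∃ T, Typing 0 0 0 t T ∧ Multitype.nature T = ν := by
  cases ν with
  | abs =>
    obtain ⟨s, rfl⟩ := h.exists_eq_lam
    -- With the empty multitype, the body of the abstraction need not be typed at all.
    exact ⟨.abs 0, (typing_lam_iff ht).2 ⟨0, rfl, Family.zero_iff.2 rfl⟩, rfl⟩
  | nat => exact ⟨.nat 0, h.natValue.typing_zero, rfl⟩

/-- Each step supplied by progress removes one entry from the counter, so the process stops in time.
Only an inequality results: a normal abstraction may keep a nonempty counter, coming from typings of
its body, which is never reduced. -/
theorem Typing.exists_steps {m : MultiCounter} {t : Term} {T : Multitype} (h : Typing m 0 0 t T)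
    (ht : t.Closed) : ∃ ρs t', Steps t ρs t' ∧ NF (Multitype.nature T).toFallible t' ∧
      ρs.length ≤ m.card := by
  induction hc : m.card generalizing m t with
  | zero =>
    rcases h.progress ht with hn | ⟨ρ, t', h'⟩
    · exact ⟨[], t, .refl t, hn, le_rfl⟩
    · obtain ⟨m', rfl, -⟩ := (h'.typing_iff ht).1 h
      simp at hc
  | succ c ih =>
    rcases h.progress ht with hn | ⟨ρ, t', h'⟩
    · exact ⟨[], t, .refl t, hn, Nat.zero_le _⟩
    · obtain ⟨m', rfl, h''⟩ := (h'.typing_iff ht).1 h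
      rw [Multiset.card_add, Multiset.card_singleton] at hc
      obtain ⟨ρs, s, hs, hn, hl⟩ := ih h'' (h'.closed ht) (by omega)
      exact ⟨ρ :: ρs, s, .step h' hs, hn, Nat.succ_le_succ hl⟩

/-- Expansion along the sequence adds exactly one entry per step to the empty counter of the normal
form. -/
theorem Steps.exists_typing {ρs : List Rule} {t t' : Term} (h : Steps t ρs t') (ht : t.Closed)
    {ν : Nature} (hn : NF ν.toFallible t') : ∃ m T, Typing m 0 0 t T ∧
      Multitype.nature T = ν ∧ ρs.length = m.card := by
  induction h with
  | refl t =>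
    obtain ⟨T, hT, hν⟩ := hn.exists_typing ht
    exact ⟨0, T, hT, hν, rfl⟩
  | step h _ ih =>
    obtain ⟨m, T, hT, hν, hl⟩ := ih (h.closed ht) hn
    exact ⟨_, T, (h.typing_iff ht).2 ⟨m, rfl, hT⟩, hν, by simp [hl, add_comm]⟩

end PCFH

theorem mainTheorem1 (t : PCFH.Term) (ht : t.Closed) (ν : PCFH.Nature) :
    (∀ (m : PCFH.MultiCounter) (Φ : PCFH.FamCtx) (Γ : PCFH.TyCtx) (T : PCFH.Multitype),
      PCFH.Typing m Φ Γ t T → PCFH.Multitype.nature T = ν →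
      ∃ (ρs : List PCFH.Rule) (t' : PCFH.Term),
        PCFH.Steps t ρs t' ∧ PCFH.NF ν.toFallible t' ∧ ρs.length ≤ m.card) ∧
    (∀ (ρs : List PCFH.Rule) (t' : PCFH.Term),
      PCFH.Steps t ρs t' → PCFH.NF ν.toFallible t' →
      ∃ (m : PCFH.MultiCounter) (Φ : PCFH.FamCtx) (Γ : PCFH.TyCtx) (T : PCFH.Multitype),
        PCFH.Typing m Φ Γ t T ∧ PCFH.Multitype.nature T = ν ∧ ρs.length = m.card) := by
  constructor
  · rintro m Φ Γ T h rfl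
    obtain ⟨rfl, rfl⟩ := h.ctx_eq_zero_of_closed ht
    exact h.exists_steps ht
  · intro ρs t' h hn
    obtain ⟨m, T, hT, hν, hl⟩ := h.exists_typing ht hn
    exact ⟨m, 0, 0, T, hT, hν, hl⟩
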